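/- For a permutation $\pi$ of $\{1,\dots,n\}$ let $\mathrm{maj}(\pi)=\sum_{i:\,\pi(i)>\pi(i+1)} i$ be its major index, let $D_n$ be the set of derangements (permutations without fixed points) of $\{1,\dots,n\}$, and let $$d_n(q)=\sum_{\pi\in D_n}q^{\mathrm{maj}(\pi)}=\sum_k A_n(k)\,q^k .$$ Put $\beta_n=\binom n2$ if $n$ is even and $\beta_n=\binom n2-1$ if $n$ is odd. For every $n\ge 2$ the polynomial $d_n(q)$ has degree $\beta_n$ and $A_n(0)=0$. For every $n\ge 6$ the coefficients $A_n(1),\dots,A_n(\beta_n)$ are positive, and the following holds. 1. If $n\equiv 1 \pmod 4$ and $r=\frac{n(n-1)}4$, then $$\frac{A_n(1)}{A_n(\beta_n)}<\frac{A_n(2)}{A_n(\beta_n-1)}<\cdots<\frac{A_n(r-1)}{A_n(r+1)}<1,\qquad \frac{A_n(\beta_n)}{A_n(2)}<\frac{A_n(\beta_n-1)}{A_n(3)}<\cdots<\frac{A_n(r+1)}{A_n(r)}<1 .$$ 2. If $n\equiv 2 \pmod 4$ and $r=\frac{n(n-1)-2}4$, then $$\frac{A_n(1)}{A_n(\beta_n-1)}<\frac{A_n(2)}{A_n(\beta_n-2)}<\cdots<\frac{A_n(r)}{A_n(r+1)}<1,\qquad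 \frac{A_n(\beta_n-1)}{A_n(2)}<\frac{A_n(\beta_n-2)}{A_n(3)}<\cdots<\frac{A_n(r+2)}{A_n(r)}<1 .$$ 3. If $n\equiv 3 \pmod 4$ and $r=\frac{n(n-1)-2}4$, then $$\frac{A_n(1)}{A_n(\beta_n)}<\frac{A_n(2)}{A_n(\beta_n-1)}<\cdots<\frac{A_n(r)}{A_n(r+1)}<1,\qquad \frac{A_n(\beta_n)}{A_n(2)}<\frac{A_n(\beta_n-1)}{A_n(3)}<\cdots<\frac{A_n(r+2)}{A_n(r)}<1 .$$ 4. If $n\equiv 0 \pmod 4$ and $r=\frac{n(n-1)}4$, then $$\frac{A_n(1)}{A_n(\beta_n-1)}<\frac{A_n(2)}{A_n(\beta_n-2)}<\cdots<\frac{A_n(r-1)}{A_n(r+1)}<1,\qquad \frac{A_n(\beta_n-1)}{A_n(2)}<\frac{A_n(\beta_n-2)}{A_n(3)}<\cdots<\frac{A_n(r+1)}{A_n(r)}<1 .$$ Moreover, for every $n\ge 6$, put $L=\beta_n$ if $n$ is odd and $L=\beta_n-1$ if $n$ is even (so that the last coefficient is skipped for even $n$). Then the sequence $A_n(1),\dots,A_n(L)$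 has the spiral property $$A_n(1)<A_n(L)<A_n(2)<A_n(L-1)<A_n(3)<\cdots$$ (continued until all the terms are used up) and is strictly log-concave: $$\frac{A_n(1)}{A_n(2)}<\frac{A_n(2)}{A_n(3)}<\cdots<\frac{A_n(L-1)}{A_n(L)} .$$ -/

import Mathlib

namespace QDerangement

/-- The major index of a permutation of an `n`-element linearly ordered set of positions: the sum of
its descents, that is of all `i` with `1 ≤ i ≤ n - 1` and `σ(i) > σ(i + 1)` in one-based one-line
notation. In zero-based notation the one-based position `i` has value `i - 1` and the one-based
position `i + 1` has value `i`, so the descent `i` is recorded as the value of the right position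
`j` of the two. -/
def maj {n : ℕ} (σ : Equiv.Perm (Fin n)) : ℕ :=
  ∑ j : Fin n, if ∃ i : Fin n, (i : ℕ) + 1 = (j : ℕ) ∧ σ j < σ i then (j : ℕ) else 0

/-- The `q`-derangement number `d_n(q)`: the sum of `q ^ maj(σ)` over all derangements `σ`, as a
polynomial in `q`. -/
noncomputable def d (n : ℕ) : Polynomial ℤ :=
  ∑ σ : derangements (Fin n), Polynomial.X ^ maj (σ : Equiv.Perm (Fin n))

/-- The coefficient `A_n(k)` of `q ^ k` in `d_n(q)`, as a rational number. -/
noncomputable def A (n k : ℕ) : ℚ := ((d n).coeff k : ℚ)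

/-- The number `β_n`: it is `C(n, 2)` for even `n` and `C(n, 2) - 1` for odd `n`. -/
def beta (n : ℕ) : ℕ := if Even n then n.choose 2 else n.choose 2 - 1

/-- `f a < f (a + 1) < ⋯ < f b < 1`. -/
def IncreasingBelowOne (f : ℕ → ℚ) (a b : ℕ) : Prop :=
  a ≤ b ∧ (∀ k, a ≤ k → k < b → f k < f (k + 1)) ∧ f b < 1

/-- The spiral property of the sequence `a_1, …, a_L`:
`a_1 < a_L < a_2 < a_{L-1} < a_3 < ⋯`, continued until all the terms are used up. -/
def Spiral (a : ℕ → ℚ) (L : ℕ) : Prop :=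
  (∀ k, 1 ≤ k → k < L + 1 - k → a k < a (L + 1 - k)) ∧
    ∀ k, 1 ≤ k → k + 1 < L + 1 - k → a (L + 1 - k) < a (k + 1)

/-- Log-concavity of the positive sequence `a_1, …, a_L`, in the strict sense:
`a_1 / a_2 < a_2 / a_3 < ⋯ < a_{L-1} / a_L`. -/
def StrictlyLogConcave (a : ℕ → ℚ) (L : ℕ) : Prop :=
  (∀ k, 1 ≤ k → k ≤ L → 0 < a k) ∧
    ∀ k, 1 ≤ k → k + 2 ≤ L → a k / a (k + 1) < a (k + 1) / a (k + 2)

end QDerangement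

/-! The proof rests on Wachs's recurrence `d_succ`: d_{n+1} = [n+1] d_n + (-1)^{n+1} q^{C(n+1,2)},
where [m] = 1 + q + ⋯ + q^{m-1}.

The recurrence comes from counting words over ℕ by their sum. Stable sorting into decreasing order
turns a word into a permutation and a compatible function, and fixed points of the permutation
correspond to "balanced" letters. So words without balanced letters have generating function d_n(q)
/ ((1-q)⋯(1-q^n)) (`unbalancedGF_eq`). A balanced letter can be removed and reinserted without
disturbing the balance of other letters (`balanced_insertBalanced_iff`). Sieving the letters one by
one gives a second recursion for the same series (`unbalancedGF_succ`), and comparing the two yields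
`d_succ`.

For the inequalities, drop the isolated top term q^{C(n,2)} when n is even; the rest is `core n`,
supported on 1, …, L with L = C(n,2) - 1. Both ratio chains say that the 2×2 minors of the sequence
against its reversal have a fixed sign; this is `RatioMonotone`. Multiplying by [m] writes each new
consecutive minor as a sum of old minors (`minor_window`), so the property survives: this is the
step from odd to even n. From even to odd n, the dropped term also adds 1 to a block of top
coefficients. `RatioMonotone.addTail_window` absorbs this perturbation under a few inequalities on
the extreme coefficients. `EvenInvariant` carries explicit formulas for those coefficients through
the induction, which starts at n = 6.

The spiral property and log-concavity then follow from the two families of minors. -/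

namespace QDerangement
open PowerSeries

/-! ### Generating functions of weighted sets -/

/-- The generating function of a weighted set. -/
noncomputable def gf {α : Type*} (ω : α → ℕ) : ℤ⟦X⟧ :=
  PowerSeries.mk fun N => (Nat.card {x // ω x = N} : ℤ)

lemma coeff_gf {α : Type*} (ω : α → ℕ) (N : ℕ) :
    coeff N (gf ω) = (Nat.card {x // ω x = N} : ℤ) := coeff_mk _ _

lemma gf_equiv {α β : Type*} (e : α ≃ β) {ω : α → ℕ} {ω' : β → ℕ} (h : ∀ x, ω' (e x) = ω x) :
    gf ω = gf ω' := by
  ext N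
  rw [coeff_gf, coeff_gf]
  congr 1
  exact Nat.card_congr (e.subtypeEquiv fun x => by rw [h])

lemma gf_shift {α : Type*} (ω : α → ℕ) (c : ℕ) : gf (fun x => ω x + c) = X ^ c * gf ω := by
  ext N
  rw [coeff_gf, coeff_X_pow_mul']
  split_ifs with h
  · rw [coeff_gf]
    congr 1
    exact Nat.card_congr (Equiv.subtypeEquivRight fun x => by omega)
  · have : IsEmpty {x // ω x + c = N} := ⟨fun x => by have := x.2; omega⟩
    simp

lemma gf_sum {α β : Type*} (ω : α → ℕ) (ω' : β → ℕ) (h : ∀ N, Finite {x // ω x = N})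
    (h' : ∀ N, Finite {x // ω' x = N}) : gf (Sum.elim ω ω') = gf ω + gf ω' := by
  ext N
  rw [map_add, coeff_gf, coeff_gf, coeff_gf]
  have := h N
  have := h' N
  rw [← Nat.cast_add, ← Nat.card_sum]
  congr 1
  exact Nat.card_congr (Equiv.subtypeSum (p := fun c => Sum.elim ω ω' c = N))

lemma gf_sigma {ι : Type*} [Fintype ι] {β : ι → Type*} (ω : ∀ i, β i → ℕ)
    (h : ∀ i N, Finite {x // ω i x = N}) :
    gf (fun x : Σ i, β i => ω x.1 x.2) = ∑ i, gf (ω i) := by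
  ext N
  rw [map_sum, coeff_gf]
  simp_rw [coeff_gf]
  have := fun i => h i N
  rw [← Nat.cast_sum, ← Nat.card_sigma]
  congr 1
  exact Nat.card_congr
    { toFun := fun x => ⟨x.1.1, x.1.2, x.2⟩
      invFun := fun x => ⟨⟨x.1, x.2.1⟩, x.2.2⟩
      left_inv := fun x => rfl
      right_inv := fun x => rfl }

lemma gf_prod {α β : Type*} (ω : α → ℕ) (ω' : β → ℕ) (h : ∀ N, Finite {x // ω x = N})
    (h' : ∀ N, Finite {x // ω' x = N}) :
    gf (fun x : α × β => ω x.1 + ω' x.2) = gf ω * gf ω' := by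
  ext N
  rw [coeff_mul, coeff_gf]
  simp_rw [coeff_gf]
  have i1 : ∀ p : Finset.HasAntidiagonal.antidiagonal N, Finite {x // ω x = p.1.1} := fun p => h _
  have i2 : ∀ p : Finset.HasAntidiagonal.antidiagonal N, Finite {x // ω' x = p.1.2} := fun p => h' _
  have key : Nat.card {x : α × β // ω x.1 + ω' x.2 = N} =
      ∑ p : Finset.HasAntidiagonal.antidiagonal N,
        Nat.card {x // ω x = p.1.1} * Nat.card {x // ω' x = p.1.2} := by
    simp_rw [← Nat.card_prod]
    rw [← Nat.card_sigma]
    exact Nat.card_congr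
      { toFun := fun x => ⟨⟨(ω x.1.1, ω' x.1.2), Finset.HasAntidiagonal.mem_antidiagonal.2 x.2⟩,
          ⟨x.1.1, rfl⟩, ⟨x.1.2, rfl⟩⟩
        invFun := fun x => ⟨(x.2.1.1, x.2.2.1), by
          rw [x.2.1.2, x.2.2.2]; exact Finset.HasAntidiagonal.mem_antidiagonal.1 x.1.2⟩
        left_inv := fun x => rfl
        right_inv := by
          rintro ⟨⟨⟨a, b⟩, hp⟩, ⟨x, hx⟩, ⟨y, hy⟩⟩
          dsimp only at hx hy
          subst hx hy
          rfl }
  rw [key, Finset.univ_eq_attach, Nat.cast_sum]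
  simp only [Nat.cast_mul]
  exact Finset.sum_attach (Finset.HasAntidiagonal.antidiagonal N)
    (fun p => (Nat.card {x // ω x = p.1} : ℤ) * (Nat.card {x // ω' x = p.2} : ℤ))

lemma gf_id : gf (fun n : ℕ => n) = PowerSeries.mk 1 := by
  ext N
  rw [coeff_gf, coeff_mk]
  have : Unique {x : ℕ // x = N} := Unique.subtypeEq N
  simp

lemma gf_unique {α : Type*} [Unique α] (ω : α → ℕ) (h : ω default = 0) : gf ω = 1 := by
  ext N
  rw [coeff_gf, coeff_one]
  split_ifs with hN
  · have : Unique {x // ω x = N} :=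
      { default := ⟨default, by rw [h, hN]⟩
        uniq := fun x => Subtype.ext (Unique.eq_default _) }
    simp
  · have : IsEmpty {x // ω x = N} :=
      ⟨fun x => hN (by rw [← x.2, Unique.eq_default x.1, h])⟩
    simp

lemma finite_fun_sum_eq (n N : ℕ) : Finite {g : Fin n → ℕ // ∑ i, g i = N} := by
  refine Finite.of_injective
    (fun g : {g : Fin n → ℕ // ∑ i, g i = N} => fun i : Fin n => (⟨g.1 i, ?_⟩ : Fin (N + 1))) ?_
  · have := Finset.single_le_sum (f := g.1) (fun _ _ => Nat.zero_le _) (Finset.mem_univ i)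
    have := g.2
    omega
  · intro g g' h
    apply Subtype.ext
    funext i
    have := congrFun h i
    simpa using this

lemma finite_list_sum_eq (n N : ℕ) : Finite {w : List ℕ // w.length = n ∧ w.sum = N} := by
  have := finite_fun_sum_eq n N
  refine Finite.of_injective (fun w : {w : List ℕ // w.length = n ∧ w.sum = N} =>
    (⟨fun i : Fin n => w.1[i]'(by rw [w.2.1]; exact i.2), ?_⟩ :
      {g : Fin n → ℕ // ∑ i, g i = N})) ?_
  · obtain ⟨w, rfl, rfl⟩ := w
    exact Fin.sum_univ_getElem w
  · rintro ⟨w, hw, hs⟩ ⟨w', hw', hs'⟩ h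
    apply Subtype.ext
    have h1 := congrArg Subtype.val h
    apply List.ext_getElem (by rw [hw, hw'])
    intro i hi hi'
    exact congrFun h1 ⟨i, hw ▸ hi⟩

/-! ### Balanced letters and their insertion -/

/-- The letter `v` occurs in `w` at a position preceded by exactly as many letters different from
`v` as `w` has letters larger than `v`. Such a position is a fixed point of the permutation that
sorts `w` into weakly decreasing order. -/
def Balanced (v : ℕ) (w : List ℕ) : Prop :=
  ∃ a b, w = a ++ v :: b ∧ a.countP (· ≠ v) = w.countP (v < ·)

/-- Insert the letter `v` after the first `s` letters different from `v`. -/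
def insertAfter (v : ℕ) : ℕ → List ℕ → List ℕ
  | 0, w => v :: w
  | _ + 1, [] => [v]
  | s + 1, x :: w => x :: insertAfter v (if x = v then s + 1 else s) w

/-- Admissible insertion places differ only by copies of `v` between them, so all of them give the
same word; insertion is therefore canonical. -/
lemma insertAfter_append (v : ℕ) (a b : List ℕ) :
    insertAfter v (a.countP (· ≠ v)) (a ++ b) = a ++ v :: b := by
  induction a with
  | nil => simp [insertAfter]
  | cons x a ih =>
    by_cases hx : x = v
    · subst hx
      rw [List.countP_cons_of_neg (by simp)]
      rcases h : List.countP (fun y => decide (y ≠ x)) a with _ | s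
      · rw [h] at ih
        simp only [insertAfter] at ih ⊢
        rw [List.cons_append, List.cons_append, ← ih]
      · rw [h] at ih
        simp [insertAfter, ← ih]
    · rw [List.countP_cons_of_pos (by simpa using hx), List.cons_append, insertAfter, if_neg hx, ih,
        List.cons_append]

lemma exists_append_countP (v s : ℕ) (w : List ℕ) (h : s ≤ w.countP (· ≠ v)) :
    ∃ a b, w = a ++ b ∧ a.countP (· ≠ v) = s := by
  induction w generalizing s with
  | nil => exact ⟨[], [], rfl, by simpa using (Nat.le_zero.1 h).symm⟩
  | cons x w ih =>
    rcases s with _ | s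
    · exact ⟨[], x :: w, rfl, rfl⟩
    · by_cases hx : x = v
      · subst hx
        rw [List.countP_cons_of_neg (by simp)] at h
        obtain ⟨a, b, hw, ha⟩ := ih (s + 1) h
        exact ⟨x :: a, b, by rw [hw]; rfl, by rw [List.countP_cons_of_neg (by simp), ha]⟩
      · rw [List.countP_cons_of_pos (by simpa using hx)] at h
        obtain ⟨a, b, hw, ha⟩ := ih s (by omega)
        exact ⟨x :: a, b, by rw [hw]; rfl,
          by rw [List.countP_cons_of_pos (by simpa using hx), ha]⟩

lemma insertAfter_injective (v s : ℕ) : Function.Injective (insertAfter v s) := by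
  intro w w' h
  induction w generalizing s w' with
  | nil =>
    rcases s with _ | s
    · simpa [insertAfter] using h
    · rcases w' with _ | ⟨y, w'⟩
      · rfl
      · simp only [insertAfter, List.cons.injEq] at h
        have := h.2
        split_ifs at this <;> rcases w' with _ | ⟨z, w'⟩ <;> rcases s with _ | s <;>
          simp [insertAfter] at this
  | cons x w ih =>
    rcases s with _ | s
    · simpa [insertAfter] using h
    · rcases w' with _ | ⟨y, w'⟩
      · simp only [insertAfter, List.cons.injEq] at h
        have := h.2
        split_ifs at this <;> rcases w with _ | ⟨z, w⟩ <;> rcases s with _ | s <;>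
          simp [insertAfter] at this
      · simp only [insertAfter, List.cons.injEq] at h
        obtain ⟨rfl, h⟩ := h
        rw [ih _ h]

/-- Insert the letter `v` so that it becomes balanced. -/
def insertBalanced (v : ℕ) (w : List ℕ) : List ℕ := insertAfter v (w.countP (v < ·)) w

/-- Ensures that `insertBalanced` always finds its place, so the clause of `insertAfter` for words
that are too short plays no role there. -/
lemma countP_gt_le_countP_ne (v : ℕ) (w : List ℕ) : w.countP (v < ·) ≤ w.countP (· ≠ v) :=
  List.countP_mono_left fun x _ h => by
    simp only [decide_eq_true_eq] at h ⊢
    omega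

lemma insertBalanced_spec (v : ℕ) (w : List ℕ) : ∃ a b, w = a ++ b ∧
    insertBalanced v w = a ++ v :: b ∧ a.countP (· ≠ v) = w.countP (v < ·) := by
  obtain ⟨a, b, hw, ha⟩ := exists_append_countP v _ w (countP_gt_le_countP_ne v w)
  refine ⟨a, b, hw, ?_, ha⟩
  rw [insertBalanced, ← ha]
  conv_lhs => rw [hw]
  exact insertAfter_append v a b

lemma insertBalanced_eq (v : ℕ) (a b : List ℕ)
    (h : a.countP (· ≠ v) = (a ++ v :: b).countP (v < ·)) :
    insertBalanced v (a ++ b) = a ++ v :: b := by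
  rw [← insertAfter_append, h, insertBalanced]
  congr 1
  simp [List.countP_append]

lemma length_insertBalanced (v : ℕ) (w : List ℕ) :
    (insertBalanced v w).length = w.length + 1 := by
  obtain ⟨a, b, h, h', -⟩ := insertBalanced_spec v w
  rw [h', h]
  simp
  omega

lemma sum_insertBalanced (v : ℕ) (w : List ℕ) :
    (insertBalanced v w).sum = w.sum + v := by
  obtain ⟨a, b, h, h', -⟩ := insertBalanced_spec v w
  rw [h', h]
  simp
  omega

lemma countP_insertBalanced (p : ℕ → Bool) (v : ℕ) (w : List ℕ) :
    (insertBalanced v w).countP p = w.countP p + if p v then 1 else 0 := by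
  obtain ⟨a, b, h, h', -⟩ := insertBalanced_spec v w
  rw [h', h, List.countP_append, List.countP_append, List.countP_cons]
  omega

lemma balanced_insertBalanced (v : ℕ) (w : List ℕ) : Balanced v (insertBalanced v w) := by
  obtain ⟨a, b, h, h', hc⟩ := insertBalanced_spec v w
  refine ⟨a, b, h', ?_⟩
  rw [countP_insertBalanced, hc]
  simp

lemma insertBalanced_injective (v : ℕ) : Function.Injective (insertBalanced v) := by
  intro w w' h
  have := congrArg (List.countP (v < ·)) h
  simp only [countP_insertBalanced, lt_irrefl, decide_false] at this
  rw [insertBalanced, insertBalanced, Nat.add_right_cancel this] at h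
  exact insertAfter_injective _ _ h

lemma Balanced.exists_insertBalanced {v : ℕ} {w : List ℕ} (h : Balanced v w) :
    ∃ w', insertBalanced v w' = w := by
  obtain ⟨a, b, rfl, hc⟩ := h
  exact ⟨a ++ b, insertBalanced_eq v a b hc⟩

lemma countP_ne_add (u : ℕ) (w : List ℕ) :
    w.countP (· ≠ u) + w.countP (· = u) = w.length := by
  have := List.length_eq_countP_add_countP (p := fun x => decide (x = u)) (l := w)
  simp only [decide_eq_true_eq, ne_eq] at *
  omega

lemma countP_gt_add_le {u v : ℕ} (huv : u < v) (w : List ℕ) :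
    w.countP (v < ·) + w.countP (· = v) ≤ w.countP (u < ·) := by
  induction w with
  | nil => simp
  | cons x w ih =>
    simp only [List.countP_cons, decide_eq_true_eq]
    split_ifs <;> omega

/-- Inserting a balanced letter does not affect which other letters are balanced. -/
lemma balanced_insertBalanced_iff {u v : ℕ} (huv : u ≠ v) (w : List ℕ) :
    Balanced u (insertBalanced v w) ↔ Balanced u w := by
  obtain ⟨a, b, hw, hi, hc⟩ := insertBalanced_spec v w
  have hs : (insertBalanced v w).countP (u < ·) = w.countP (u < ·) + if u < v then 1 else 0 := by
    simpa using countP_insertBalanced (fun x => decide (u < x)) v w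
  have huv' : v ≠ u := huv.symm
  have ka := countP_ne_add v a
  -- A `u` standing before the inserted `v`. If `u < v`, too few letters precede it for either
  -- equality to hold; if `u > v`, neither count changes.
  have left : ∀ c f, a = c ++ u :: f →
      (c.countP (· ≠ u) = (insertBalanced v w).countP (u < ·) ↔
        c.countP (· ≠ u) = w.countP (u < ·)) := by
    intro c f hcf
    rw [hs]
    split_ifs with hlt
    · have k1 := countP_gt_add_le hlt w
      have k2 := countP_ne_add u c
      have k3 := countP_ne_add v (c ++ f)
      have k4 : w.countP (· = v) = (c ++ f).countP (· = v) + b.countP (· = v) := by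
        rw [hw, hcf]
        simp [List.countP_append, huv, add_assoc]
      have k5 : a.countP (· = v) = (c ++ f).countP (· = v) := by
        rw [hcf]
        simp [List.countP_append, huv]
      have k6 : a.length = (c ++ f).length + 1 := by rw [hcf]; simp; omega
      have k7 : c.length ≤ (c ++ f).length := by simp
      omega
    · simp
  -- A `u` standing after the inserted `v`. If `u < v`, both counts grow by one; if `u > v`, too
  -- many letters precede it for either equality to hold.
  have right : ∀ f e, b = f ++ u :: e →
      ((a ++ v :: f).countP (· ≠ u) = (insertBalanced v w).countP (u < ·) ↔
        (a ++ f).countP (· ≠ u) = w.countP (u < ·)) := by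
    intro f e hfe
    have k0 : (a ++ v :: f).countP (· ≠ u) = (a ++ f).countP (· ≠ u) + 1 := by
      simp only [List.countP_append]
      rw [List.countP_cons_of_pos (by simpa using huv')]
      omega
    rw [hs, k0]
    split_ifs with hlt
    · omega
    · have k1 := countP_gt_add_le (lt_of_le_of_ne (not_lt.1 hlt) huv') w
      have k2 := countP_ne_add u (a ++ f)
      have k4 : w.countP (· = u) = (a ++ f).countP (· = u) + (e.countP (· = u) + 1) := by
        rw [hw, hfe]
        simp [List.countP_append, add_assoc]
      have k6 : a.length ≤ (a ++ f).length := by simp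
      omega
  constructor
  · rintro ⟨c, e, h1, h2⟩
    rw [hi, List.append_eq_append_iff] at h1
    rcases h1 with ⟨f, rfl, hf⟩ | ⟨f, rfl, hf⟩
    · rcases f with _ | ⟨y, f⟩
      · simp [huv'] at hf
      · simp only [List.cons_append, List.cons.injEq] at hf
        obtain ⟨rfl, hf⟩ := hf
        exact ⟨a ++ f, e, by rw [hw, hf]; simp, (right f e hf).1 h2⟩
    · rcases f with _ | ⟨y, f⟩
      · simp [huv] at hf
      · simp only [List.cons_append, List.cons.injEq] at hf
        obtain ⟨rfl, hf⟩ := hf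
        exact ⟨c, f ++ b, by rw [hw]; simp, (left c f rfl).1 h2⟩
  · rintro ⟨c, e, h1, h2⟩
    rw [hw, List.append_eq_append_iff] at h1
    rcases h1 with ⟨f, rfl, hf⟩ | ⟨f, rfl, hf⟩
    · exact ⟨a ++ v :: f, e, by rw [hi, hf]; simp, (right f e hf).2 h2⟩
    · rcases f with _ | ⟨y, f⟩
      -- Here `v` goes directly in front of this `u`, so the prefix of `u` must absorb it.
      · have hb : b = [] ++ u :: e := by simpa using hf.symm
        refine ⟨c ++ [v], e, by rw [hi, hb]; simp, ?_⟩
        have := (right [] e hb).2 (by simpa using h2)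
        simpa using this
      · simp only [List.cons_append, List.cons.injEq] at hf
        obtain ⟨rfl, hf⟩ := hf
        exact ⟨c, f ++ v :: b, by rw [hi]; simp, (left c f rfl).2 h2⟩

lemma finite_shift {α : Type*} {ω : α → ℕ} (h : ∀ N, Finite {x // ω x = N}) (c N : ℕ) :
    Finite {x // ω x + c = N} := by
  have := h (N - c)
  exact Finite.of_injective
    (fun x : {x // ω x + c = N} => (⟨x.1, by have := x.2; omega⟩ : {x // ω x = N - c}))
    fun x y h => Subtype.ext (by simpa using h)

/-! ### Sieving words by their balanced letters -/

/-- The words of length `n` satisfying `P`. -/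
abbrev Word (n : ℕ) (P : List ℕ → Prop) : Type := {w : List ℕ // w.length = n ∧ P w}

/-- The generating function, by sum, of the words of length `n` satisfying `P`. -/
noncomputable def wordGF (n : ℕ) (P : List ℕ → Prop) : ℤ⟦X⟧ :=
  gf fun w : Word n P => w.1.sum

lemma finite_word (n : ℕ) (P : List ℕ → Prop) (N : ℕ) :
    Finite {w : Word n P // w.1.sum = N} := by
  have := finite_list_sum_eq n N
  exact Finite.of_injective
    (fun w : {w : Word n P // w.1.sum = N} =>
      (⟨w.1.1, w.1.2.1, w.2⟩ : {w : List ℕ // w.length = n ∧ w.sum = N}))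
    fun w w' h => Subtype.ext (Subtype.ext (by simpa using h))

/-- The words of length `n` without balanced letters below `j`. -/
noncomputable def partGF (n j : ℕ) : ℤ⟦X⟧ := wordGF n fun w => ∀ v < j, ¬ Balanced v w

/-- The words of length `n` without balanced letters. -/
noncomputable def unbalancedGF (n : ℕ) : ℤ⟦X⟧ := wordGF n fun w => ∀ v, ¬ Balanced v w

lemma not_balanced_nil (v : ℕ) : ¬ Balanced v [] := by
  rintro ⟨a, b, h, -⟩
  simp at h

lemma wordGF_zero (P : List ℕ → Prop) (h : P []) : wordGF 0 P = 1 := by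
  let u : Unique (Word 0 P) :=
    { default := ⟨[], rfl, h⟩
      uniq := fun w => Subtype.ext (List.length_eq_zero_iff.1 w.2.1) }
  exact gf_unique _ rfl

lemma partGF_zero (j : ℕ) : partGF 0 j = 1 := wordGF_zero _ fun v _ => not_balanced_nil v

lemma partGF_succ_zero (n : ℕ) : partGF (n + 1) 0 = PowerSeries.mk 1 * partGF n 0 := by
  rw [← gf_id, partGF, partGF, wordGF, wordGF,
    ← gf_prod _ _ (fun N => Set.finite_coe_iff.2 (Set.finite_singleton N)) (finite_word n _)]
  refine (gf_equiv (e := ⟨fun x => ⟨x.1 :: x.2.1, by simp [x.2.2.1], by simp⟩,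
    fun w => (w.1.head (by rintro h; simpa [h] using w.2.1), ⟨w.1.tail, by simp [w.2.1], by simp⟩),
    fun x => rfl, fun w => Subtype.ext (List.cons_head_tail _)⟩) fun x => ?_).symm
  exact List.sum_cons

/-- Split by whether `j` is balanced. If it is, remove it: the shorter word still has no balanced
letter below `j`, though `j` itself may be balanced again. -/
lemma partGF_succ (n j : ℕ) :
    partGF (n + 1) j = partGF (n + 1) (j + 1) + X ^ j * partGF n j := by
  classical
  rw [partGF, partGF, partGF, wordGF, wordGF, wordGF, ← gf_shift, ← gf_sum]
  · let f : Word (n + 1) (fun w => ∀ v < j + 1, ¬ Balanced v w) ⊕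
        Word n (fun w => ∀ v < j, ¬ Balanced v w) →
        Word (n + 1) (fun w => ∀ v < j, ¬ Balanced v w) :=
      Sum.elim (fun w => ⟨w.1, w.2.1, fun v hv => w.2.2 v (by omega)⟩)
        (fun w => ⟨insertBalanced j w.1, by rw [length_insertBalanced, w.2.1], fun v hv => by
          rw [balanced_insertBalanced_iff hv.ne]; exact w.2.2 v hv⟩)
    have hf : Function.Bijective f := by
      constructor
      · rintro (w | w) (w' | w') h <;> have h := congrArg Subtype.val h <;> dsimp [f] at h
        · exact congrArg _ (Subtype.ext h)
        · exact (w.2.2 j (by omega) (h ▸ balanced_insertBalanced j w'.1)).elim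
        · exact (w'.2.2 j (by omega) (h ▸ balanced_insertBalanced j w.1)).elim
        · exact congrArg _ (Subtype.ext (insertBalanced_injective j h))
      · rintro ⟨w, hw, hb⟩
        by_cases hj : Balanced j w
        · obtain ⟨w', rfl⟩ := hj.exists_insertBalanced
          refine ⟨Sum.inr ⟨w', ?_, fun v hv => ?_⟩, rfl⟩
          · simpa [length_insertBalanced] using hw
          · rw [← balanced_insertBalanced_iff hv.ne]
            exact hb v hv
        · refine ⟨Sum.inl ⟨w, hw, fun v hv => ?_⟩, rfl⟩
          rcases Nat.lt_succ_iff_lt_or_eq.1 hv with h | rfl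
          · exact hb v h
          · exact hj
    refine (gf_equiv (Equiv.ofBijective f hf) ?_).symm
    rintro (w | w)
    · rfl
    · exact sum_insertBalanced j w.1
  · exact finite_word _ _
  · exact finite_shift (finite_word n _) j

lemma Balanced.le_sum {v : ℕ} {w : List ℕ} (h : Balanced v w) : v ≤ w.sum := by
  obtain ⟨a, b, rfl, -⟩ := h
  simp
  omega

/-- A balanced letter is at most the sum of the word, so in degrees below `j` only letters below `j`
matter. -/
lemma X_pow_dvd_unbalancedGF_sub (n j : ℕ) : X ^ j ∣ unbalancedGF n - partGF n j := by
  rw [X_pow_dvd_iff]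
  intro N hN
  rw [map_sub, sub_eq_zero, unbalancedGF, partGF, wordGF, wordGF, coeff_gf, coeff_gf]
  congr 1
  refine Nat.card_congr
    ⟨fun w => ⟨⟨w.1.1, w.1.2.1, fun v _ => w.1.2.2 v⟩, w.2⟩,
      fun w => ⟨⟨w.1.1, w.1.2.1, fun v hv => w.1.2.2 v ?_ hv⟩, w.2⟩, fun _ => rfl, fun _ => rfl⟩
  have := hv.le_sum
  have := w.2
  omega

/-- The elementary symmetric polynomial of degree `n` in `1, X, …, X ^ (j - 1)`. -/
noncomputable def elemGF : ℕ → ℕ → ℤ⟦X⟧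
  | 0, _ => 1
  | _ + 1, 0 => 0
  | n + 1, j + 1 => elemGF (n + 1) j + X ^ j * elemGF n j

lemma elemGF_zero (j : ℕ) : elemGF 0 j = 1 := by cases j <;> rfl

lemma elemGF_rec (n j : ℕ) :
    elemGF (n + 1) (j + 1) = elemGF (n + 1) j + X ^ j * elemGF n j := by rw [elemGF]

/-- Induction on `j`: the sieve recursion at lengths `n + 1` and `n` matches the recursion of the
elementary symmetric polynomials up to the alternating sign. -/
lemma partGF_succ_eq (n j : ℕ) :
    partGF (n + 1) j = PowerSeries.mk 1 * partGF n j + (-1) ^ (n + 1) * elemGF (n + 1) j := by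
  induction j generalizing n with
  | zero => rw [partGF_succ_zero, elemGF, mul_zero, add_zero]
  | succ j ih =>
    have h1 := partGF_succ n j
    rw [← sub_eq_iff_eq_add] at h1
    rw [← h1, ih n, elemGF]
    rcases n with _ | n
    · rw [partGF_zero, partGF_zero, elemGF]
      ring
    · rw [← sub_eq_iff_eq_add.2 (partGF_succ n j), ih n]
      ring

/-- Separates the variable 1 instead of the variable `X ^ j`; the remaining variables are `X` times
`1, …, X ^ (j - 1)`. -/
lemma elemGF_succ_succ (n j : ℕ) :
    elemGF (n + 1) (j + 1) = X ^ (n + 1) * elemGF (n + 1) j + X ^ n * elemGF n j := by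
  induction j generalizing n with
  | zero => rcases n with _ | n <;> simp [elemGF]
  | succ j ih =>
    have a := elemGF_rec n (j + 1)
    have b := elemGF_rec n j
    rcases n with _ | n
    · have c := ih 0
      simp only [elemGF_zero] at a b c ⊢
      linear_combination a + c - X * b
    · linear_combination a + ih (n + 1) + X ^ (j + 1) * ih n - X ^ (n + 2) * b -
        X ^ (n + 1) * elemGF_rec n j

/-! ### Weakly decreasing sequences and the limit of the sieve -/

/-- The weakly decreasing sequences of length `n`. -/
noncomputable def antitoneGF (n : ℕ) : ℤ⟦X⟧ :=
  gf fun f : {f : Fin n → ℕ // Antitone f} => ∑ i, f.1 i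

lemma finite_antitone (n N : ℕ) : Finite {f : {f : Fin n → ℕ // Antitone f} // ∑ i, f.1 i = N} := by
  have := finite_fun_sum_eq n N
  exact Finite.of_injective
    (fun f : {f : {f : Fin n → ℕ // Antitone f} // ∑ i, f.1 i = N} =>
      (⟨f.1.1, f.2⟩ : {f : Fin n → ℕ // ∑ i, f i = N}))
    fun w w' h => Subtype.ext (Subtype.ext (by simpa using h))

lemma antitoneGF_zero : antitoneGF 0 = 1 := by
  let u : Unique {f : Fin 0 → ℕ // Antitone f} :=
    { default := ⟨fun _ => 0, fun _ _ _ => le_rfl⟩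
      uniq := fun w => Subtype.ext (Subsingleton.elim _ _) }
  exact gf_unique _ rfl

/-- Either the last entry is 0 and can be deleted, or every entry is positive and 1 can be
subtracted from each. -/
lemma antitoneGF_succ (n : ℕ) :
    antitoneGF (n + 1) = antitoneGF n + X ^ (n + 1) * antitoneGF (n + 1) := by
  conv_lhs => rw [antitoneGF]
  rw [antitoneGF, antitoneGF, ← gf_shift, ← gf_sum _ _ (finite_antitone n)]
  · let f : {f : Fin n → ℕ // Antitone f} ⊕ {f : Fin (n + 1) → ℕ // Antitone f} →
        {f : Fin (n + 1) → ℕ // Antitone f} :=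
      Sum.elim (fun f => ⟨Fin.snoc (α := fun _ => ℕ) f.1 0, by
          intro i j hij
          induction j using Fin.lastCases with
          | last => simp
          | cast j =>
            induction i using Fin.lastCases with
            | last => exact absurd hij (not_le.2 (Fin.castSucc_lt_last j))
            | cast i => simpa using f.2 (by simpa using hij)⟩)
        (fun f => ⟨fun i => f.1 i + 1, fun i j h => Nat.succ_le_succ (f.2 h)⟩)
    have hf : Function.Bijective f := by
      constructor
      · rintro (g | g) (g' | g') h <;> have h := congrArg Subtype.val h <;> dsimp [f] at h
        · refine congrArg _ (Subtype.ext ?_)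
          funext i
          simpa using congrFun h i.castSucc
        · simpa using congrFun h (Fin.last n)
        · simpa using congrFun h (Fin.last n)
        · refine congrArg _ (Subtype.ext ?_)
          funext i
          simpa using congrFun h i
      · rintro ⟨g, hg⟩
        rcases h : g (Fin.last n) with _ | k
        · refine ⟨Sum.inl ⟨fun i => g i.castSucc, fun i j hij => hg (by simpa using hij)⟩, ?_⟩
          apply Subtype.ext
          funext i
          induction i using Fin.lastCases with
          | last => simp [f, h]
          | cast i => simp [f]
        · refine ⟨Sum.inr ⟨fun i => g i - 1, fun i j hij => Nat.sub_le_sub_right (hg hij) 1⟩, ?_⟩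
          apply Subtype.ext
          funext i
          have := hg (Fin.le_last i)
          simp only [f, Sum.elim_inr]
          omega
    refine (gf_equiv (Equiv.ofBijective f hf) ?_).symm
    rintro (g | g)
    · simp [f, Fin.sum_univ_castSucc]
    · simp [f, Finset.sum_add_distrib]
  · exact finite_shift (finite_antitone (n + 1)) (n + 1)

lemma isUnit_one_sub_X_pow (n : ℕ) : IsUnit (1 - X ^ (n + 1) : ℤ⟦X⟧) := by
  rw [isUnit_iff_constantCoeff]
  simp

/-- Modulo `X ^ j` the two recursions of `elemGF` combine into `(1 - X ^ (n + 1)) e_{n+1} = X ^ n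
e_n`, which the shifted `antitoneGF` also satisfies; the factor is a unit. -/
lemma X_pow_dvd_elemGF_sub (n j : ℕ) :
    X ^ j ∣ elemGF n j - X ^ n.choose 2 * antitoneGF n := by
  induction n with
  | zero => simp [elemGF, antitoneGF_zero]
  | succ n ih =>
    have h1 := elemGF_succ_succ n j
    rw [elemGF] at h1
    have h2 := antitoneGF_succ n
    rw [← (isUnit_one_sub_X_pow n).dvd_mul_left]
    have h3 : (1 - X ^ (n + 1)) * (elemGF (n + 1) j - X ^ (n + 1).choose 2 * antitoneGF (n + 1)) =
        X ^ n * (elemGF n j - X ^ n.choose 2 * antitoneGF n) - X ^ j * elemGF n j := by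
      have h4 : (n + 1).choose 2 = n + n.choose 2 := by
        rw [Nat.choose_succ_succ' n 1, Nat.choose_one_right]
      rw [h4, pow_add X n (n.choose 2)]
      linear_combination h1 - X ^ n * X ^ (n.choose 2) * h2
    rw [h3]
    exact dvd_sub (Dvd.dvd.mul_left ih _) (Dvd.intro _ rfl)

lemma unbalancedGF_succ (n : ℕ) :
    unbalancedGF (n + 1) = PowerSeries.mk 1 * unbalancedGF n +
      (-1) ^ (n + 1) * (X ^ (n + 1).choose 2 * antitoneGF (n + 1)) := by
  rw [← sub_eq_zero]
  ext N
  -- For the coefficient of degree `N` it suffices to sieve the letters up to `N`.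
  have h1 := X_pow_dvd_unbalancedGF_sub (n + 1) (N + 1)
  have h2 := X_pow_dvd_unbalancedGF_sub n (N + 1)
  have h3 := X_pow_dvd_elemGF_sub (n + 1) (N + 1)
  have h4 := partGF_succ_eq n (N + 1)
  have h : X ^ (N + 1) ∣ unbalancedGF (n + 1) - (PowerSeries.mk 1 * unbalancedGF n +
      (-1) ^ (n + 1) * (X ^ (n + 1).choose 2 * antitoneGF (n + 1))) := by
    have := dvd_add (dvd_sub h1 (h2.mul_left (PowerSeries.mk 1))) (h3.mul_left ((-1) ^ (n + 1)))
    convert this using 1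
    linear_combination h4
  simpa using X_pow_dvd_iff.1 h N (Nat.lt_succ_self N)

/-! ### Fixed points of the stable sorting -/

lemma countP_take_ofFn {n : ℕ} (p : ℕ → Bool) (g : Fin n → ℕ) (k : ℕ) :
    ((List.ofFn g).take k).countP p =
      (Finset.univ.filter fun y : Fin n => (y : ℕ) < k ∧ p (g y) = true).card := by
  simp only [Finset.card_filter]
  induction n generalizing k with
  | zero => simp
  | succ n ih =>
    rw [List.ofFn_succ, Fin.sum_univ_succ]
    rcases k with _ | k
    · simp
    · rw [List.take_succ_cons, List.countP_cons, ih, add_comm]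
      simp

lemma countP_ofFn {n : ℕ} (p : ℕ → Bool) (g : Fin n → ℕ) :
    (List.ofFn g).countP p = (Finset.univ.filter fun y : Fin n => p (g y) = true).card := by
  have := countP_take_ofFn p g n
  rwa [List.take_of_length_le (by simp), Finset.filter_congr fun y _ => by
    rw [and_iff_right y.2]] at this

lemma balanced_ofFn_iff {n : ℕ} (v : ℕ) (g : Fin n → ℕ) :
    Balanced v (List.ofFn g) ↔ ∃ x, g x = v ∧
      (Finset.univ.filter fun y : Fin n => y < x ∧ g y ≠ v).card =
        (Finset.univ.filter fun y : Fin n => v < g y).card := by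
  have h2 := countP_ofFn (fun y => decide (v < y)) g
  simp only [decide_eq_true_eq] at h2
  have h1 := fun k => countP_take_ofFn (fun y => decide (y ≠ v)) g k
  simp only [decide_eq_true_eq] at h1
  constructor
  · rintro ⟨a, b, hab, hc⟩
    have hlen : a.length < n := by
      have := congrArg List.length hab
      simp at this
      omega
    refine ⟨⟨a.length, hlen⟩, ?_, ?_⟩
    · have : (List.ofFn g)[a.length]'(by simpa using hlen) = v := by simp [hab]
      simpa using this
    · rw [← h2, ← hc]
      have := h1 a.length
      rw [hab, List.take_left'] at this
      · rw [this]
        rfl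
      · rfl
  · rintro ⟨x, rfl, hc⟩
    refine ⟨(List.ofFn g).take x, (List.ofFn g).drop (x + 1), ?_, ?_⟩
    · conv_lhs => rw [← List.take_append_drop x (List.ofFn g),
        List.drop_eq_getElem_cons (by simp)]
      simp
    · rw [h1, h2, ← hc]
      rfl

/-- The function `f` is weakly decreasing, and strictly decreasing at the descents of `σ`. -/
def Compatible {n : ℕ} (σ : Equiv.Perm (Fin n)) (f : Fin n → ℕ) : Prop :=
  Antitone f ∧ ∀ i j, i < j → f i = f j → σ i < σ j

/-- The stable sorting of a word into weakly decreasing order. -/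
def sortDesc {n : ℕ} (g : Fin n → ℕ) : Equiv.Perm (Fin n) := Tuple.sort (OrderDual.toDual ∘ g)

lemma eq_sortDesc_iff {n : ℕ} (σ : Equiv.Perm (Fin n)) (g : Fin n → ℕ) :
    σ = sortDesc g ↔ Compatible σ (g ∘ σ) := by
  rw [sortDesc, Tuple.eq_sort_iff]
  rfl

lemma sortDesc_symm_lt_iff {n : ℕ} (g : Fin n → ℕ) (x y : Fin n) :
    (sortDesc g).symm y < (sortDesc g).symm x ↔ g x < g y ∨ g y = g x ∧ y < x := by
  obtain ⟨h1, h2⟩ := (eq_sortDesc_iff _ g).1 rfl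
  obtain ⟨i, rfl⟩ := (sortDesc g).surjective x
  obtain ⟨j, rfl⟩ := (sortDesc g).surjective y
  rw [Equiv.symm_apply_apply, Equiv.symm_apply_apply]
  constructor
  · intro h
    rcases (h1 h.le).lt_or_eq with hlt | heq
    · exact Or.inl hlt
    · exact Or.inr ⟨heq.symm, h2 j i h heq.symm⟩
  · intro h
    by_contra! hij
    have h3 : g (sortDesc g j) ≤ g (sortDesc g i) := h1 hij
    rcases h with h | ⟨h, h'⟩
    · omega
    · rcases hij.lt_or_eq with hlt | rfl
      · exact lt_asymm h' (h2 i j hlt h.symm)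
      · exact lt_irrefl _ h'

/-- The sorted place of `x` is (larger letters) + (equal letters before `x`), while `x` itself is
(different letters before) + (equal letters before). -/
lemma sortDesc_apply_eq_iff {n : ℕ} (g : Fin n → ℕ) (x : Fin n) :
    sortDesc g x = x ↔ (Finset.univ.filter fun y : Fin n => y < x ∧ g y ≠ g x).card =
        (Finset.univ.filter fun y : Fin n => g x < g y).card := by
  have h1 : (((sortDesc g).symm x : Fin n) : ℕ) =
      (Finset.univ.filter fun y : Fin n => g x < g y).card +
        (Finset.univ.filter fun y : Fin n => y < x ∧ g y = g x).card := by
    rw [← Finset.card_union_of_disjoint, ← Finset.filter_or, ← Fin.card_Iio]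
    · refine Finset.card_bij (fun y _ => sortDesc g y) ?_ ?_ ?_
      · intro y hy
        simp only [Finset.mem_Iio] at hy
        simp only [Finset.mem_filter, Finset.mem_univ, true_and]
        have := (sortDesc_symm_lt_iff g x (sortDesc g y)).1 (by simpa using hy)
        tauto
      · intro y _ y' _ h
        exact (sortDesc g).injective h
      · intro y hy
        simp only [Finset.mem_filter, Finset.mem_univ, true_and] at hy
        refine ⟨(sortDesc g).symm y, ?_, by simp⟩
        rw [Finset.mem_Iio, sortDesc_symm_lt_iff]
        tauto
    · rw [Finset.disjoint_filter]
      intro y _ h h'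
      omega
  have h2 : (x : ℕ) = (Finset.univ.filter fun y : Fin n => y < x ∧ g y = g x).card +
      (Finset.univ.filter fun y : Fin n => y < x ∧ g y ≠ g x).card := by
    rw [← Finset.filter_filter, ← Finset.filter_filter, Finset.card_filter_add_card_filter_not]
    rw [← Fin.card_Iio]
    congr 1
    ext y
    simp
  rw [← Equiv.eq_symm_apply, Fin.ext_iff]
  omega

lemma exists_balanced_ofFn_iff {n : ℕ} (g : Fin n → ℕ) :
    (∃ v, Balanced v (List.ofFn g)) ↔ ∃ x, sortDesc g x = x := by
  simp_rw [balanced_ofFn_iff, sortDesc_apply_eq_iff]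
  constructor
  · rintro ⟨v, x, rfl, h⟩
    exact ⟨x, h⟩
  · rintro ⟨x, h⟩
    exact ⟨_, x, rfl, h⟩

lemma unbalancedGF_eq_gf (n : ℕ) :
    unbalancedGF n = gf fun g : {g : Fin n → ℕ // ∀ x, sortDesc g x ≠ x} => ∑ i, g.1 i := by
  let f : {g : Fin n → ℕ // ∀ x, sortDesc g x ≠ x} → Word n fun w => ∀ v, ¬ Balanced v w :=
    fun g => ⟨List.ofFn g.1, by simp, fun v hv => by
      obtain ⟨x, hx⟩ := (exists_balanced_ofFn_iff g.1).1 ⟨v, hv⟩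
      exact g.2 x hx⟩
  have hf : Function.Bijective f := by
    constructor
    · intro g g' h
      exact Subtype.ext (List.ofFn_injective (congrArg Subtype.val h))
    · rintro ⟨w, rfl, h⟩
      refine ⟨⟨w.get, fun x hx => ?_⟩, Subtype.ext (List.ofFn_get w)⟩
      obtain ⟨v, hv⟩ := (exists_balanced_ofFn_iff w.get).2 ⟨x, hx⟩
      rw [List.ofFn_get] at hv
      exact h v hv
  refine (gf_equiv (Equiv.ofBijective f hf) fun g => ?_).symm
  exact List.sum_ofFn

/-- A word is a permutation (its sorting) together with a compatible function (its sorted letters). -/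
lemma unbalancedGF_eq_sum (n : ℕ) :
    unbalancedGF n = ∑ σ : derangements (Fin n),
      gf fun f : {f : Fin n → ℕ // Compatible σ.1 f} => ∑ i, f.1 i := by
  classical
  rw [unbalancedGF_eq_gf, ← gf_sigma]
  · let F : (Σ σ : derangements (Fin n), {f : Fin n → ℕ // Compatible σ.1 f}) →
        {g : Fin n → ℕ // ∀ x, sortDesc g x ≠ x} := fun p => ⟨p.2.1 ∘ p.1.1.symm, by
      rw [← (eq_sortDesc_iff p.1.1 (p.2.1 ∘ p.1.1.symm)).2
        (by simpa [Function.comp_assoc] using p.2.2)]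
      exact p.1.2⟩
    have hF : Function.Bijective F := by
      constructor
      · rintro ⟨⟨σ, hσ⟩, f, hf⟩ ⟨⟨τ, hτ⟩, f', hf'⟩ h
        have h : f ∘ σ.symm = f' ∘ τ.symm := congrArg Subtype.val h
        have h1 := (eq_sortDesc_iff σ (f ∘ σ.symm)).2 (by simpa [Function.comp_assoc] using hf)
        have h2 := (eq_sortDesc_iff τ (f' ∘ τ.symm)).2 (by simpa [Function.comp_assoc] using hf')
        obtain rfl : σ = τ := by rw [h1, h, ← h2]
        obtain rfl : f = f' := σ.symm.surjective.injective_comp_right h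
        rfl
      · rintro ⟨g, hg⟩
        refine ⟨⟨⟨sortDesc g, hg⟩, g ∘ sortDesc g, (eq_sortDesc_iff _ _).1 rfl⟩, ?_⟩
        apply Subtype.ext
        simp [F, Function.comp_assoc]
    refine (gf_equiv (Equiv.ofBijective F hF) ?_).symm
    rintro ⟨⟨σ, hσ⟩, f, hf⟩
    exact Equiv.sum_comp σ.symm f
  · intro σ N
    have := finite_fun_sum_eq n N
    exact Finite.of_injective
      (fun f : {f : {f : Fin n → ℕ // Compatible σ.1 f} // ∑ i, f.1 i = N} =>
        (⟨f.1.1, f.2⟩ : {f : Fin n → ℕ // ∑ i, f i = N}))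
      fun w w' h => Subtype.ext (Subtype.ext (by simpa using h))

/-! ### Compatible functions and the major index -/

/-- The position `j` is the right position of a descent of `σ`. -/
def IsDescent {n : ℕ} (σ : Equiv.Perm (Fin n)) (j : Fin n) : Prop :=
  ∃ i : Fin n, (i : ℕ) + 1 = (j : ℕ) ∧ σ j < σ i

open Classical in
/-- The number of descents to the right of a position. -/
noncomputable def descentsAfter {n : ℕ} (σ : Equiv.Perm (Fin n)) (i : Fin n) : ℕ :=
  ∑ j : Fin n, if i < j ∧ IsDescent σ j then 1 else 0

lemma sum_descentsAfter {n : ℕ} (σ : Equiv.Perm (Fin n)) : ∑ i, descentsAfter σ i = maj σ := by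
  classical
  simp only [descentsAfter]
  rw [Finset.sum_comm, maj]
  refine Finset.sum_congr rfl fun j _ => ?_
  by_cases h : IsDescent σ j
  · rw [if_pos (c := ∃ i : Fin n, (i : ℕ) + 1 = (j : ℕ) ∧ σ j < σ i) h]
    simp only [h, and_true]
    rw [← Finset.card_filter, ← Fin.card_Iio]
    congr 1
    ext y
    simp
  · rw [if_neg (c := ∃ i : Fin n, (i : ℕ) + 1 = (j : ℕ) ∧ σ j < σ i) h]
    simp [h]

lemma isDescent_succ {n : ℕ} (σ : Equiv.Perm (Fin (n + 1))) (i : Fin n) :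
    IsDescent σ i.succ ↔ σ i.succ < σ i.castSucc := by
  constructor
  · rintro ⟨k, hk, h⟩
    have : k = i.castSucc := Fin.ext (by simpa using hk)
    rwa [this] at h
  · intro h
    exact ⟨i.castSucc, by simp, h⟩

lemma descentsAfter_castSucc {n : ℕ} (σ : Equiv.Perm (Fin (n + 1))) (i : Fin n)
    [Decidable (σ i.succ < σ i.castSucc)] :
    descentsAfter σ i.castSucc =
      descentsAfter σ i.succ + if σ i.succ < σ i.castSucc then 1 else 0 := by
  classical
  have : (if σ i.succ < σ i.castSucc then 1 else 0) =
      ∑ j, if j = i.succ then (if IsDescent σ i.succ then 1 else 0) else 0 := by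
    simp [isDescent_succ]
  rw [this, descentsAfter, descentsAfter, ← Finset.sum_add_distrib]
  refine Finset.sum_congr rfl fun j _ => ?_
  have h : i.castSucc < j ↔ i.succ < j ∨ j = i.succ := by
    rw [Fin.lt_def, Fin.lt_def, Fin.ext_iff]
    simp
    omega
  by_cases hj : j = i.succ
  · subst hj
    simp
  · simp [h, hj]

lemma antitone_sub_descentsAfter {n : ℕ} {σ : Equiv.Perm (Fin n)} {f : Fin n → ℕ}
    (h : Compatible σ f) : (∀ i, descentsAfter σ i ≤ f i) ∧
      Antitone fun i => f i - descentsAfter σ i := by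
  rcases n with _ | n
  · exact ⟨fun i => i.elim0, fun i => i.elim0⟩
  · have hstep : ∀ i : Fin n, f i.succ + descentsAfter σ i.castSucc ≤
        f i.castSucc + descentsAfter σ i.succ := by
      intro i
      rw [descentsAfter_castSucc]
      have h1 : f i.succ ≤ f i.castSucc := h.1 (Fin.castSucc_lt_succ).le
      split_ifs with hd
      · have : f i.castSucc ≠ f i.succ := fun he =>
          lt_asymm hd (h.2 _ _ Fin.castSucc_lt_succ he)
        omega
      · omega
    have hle : ∀ i, descentsAfter σ i ≤ f i := by
      intro i
      induction i using Fin.reverseInduction with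
      | last => simp [descentsAfter, not_lt.2 (Fin.le_last _)]
      | cast i ih =>
        have := hstep i
        omega
    refine ⟨hle, Fin.antitone_iff_succ_le.2 fun i => ?_⟩
    have := hstep i
    have := hle i.succ
    have := hle i.castSucc
    omega

lemma compatible_add_descentsAfter {n : ℕ} (σ : Equiv.Perm (Fin n)) {f : Fin n → ℕ}
    (h : Antitone f) : Compatible σ fun i => f i + descentsAfter σ i := by
  classical
  rcases n with _ | n
  · exact ⟨fun i => i.elim0, fun i => i.elim0⟩
  · have hd : Antitone (descentsAfter σ) := Fin.antitone_iff_succ_le.2 fun i => by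
      rw [descentsAfter_castSucc]
      omega
    refine ⟨fun i j hij => Nat.add_le_add (h hij) (hd hij), fun i j => ?_⟩
    induction j using Fin.induction with
    | zero => intro hij; exact absurd hij (Fin.not_lt_zero i)
    | succ j ih =>
      intro hij he
      have hij' : i ≤ j.castSucc := Fin.le_castSucc_iff.2 hij
      have h1 := h hij'
      have h2 := hd hij'
      have h3 : f j.succ ≤ f j.castSucc := h (Fin.castSucc_lt_succ).le
      have h4 := descentsAfter_castSucc σ j
      dsimp only at he ih
      have h5 : ¬ σ j.succ < σ j.castSucc := fun hlt => by
        rw [if_pos hlt] at h4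
        omega
      have h6 : σ j.castSucc < σ j.succ :=
        lt_of_le_of_ne (not_lt.1 h5) fun he => (Fin.castSucc_lt_succ (i := j)).ne (σ.injective he)
      rcases hij'.lt_or_eq with hlt | rfl
      · rw [if_neg h5] at h4
        exact (ih hlt (by omega)).trans h6
      · exact h6

/-- Subtracting `descentsAfter` removes exactly the strict drops forced at descents; a descent with
right position `j` is subtracted at the `j` positions before it, so the total is `maj σ`. -/
lemma gf_compatible {n : ℕ} (σ : Equiv.Perm (Fin n)) :
    gf (fun f : {f : Fin n → ℕ // Compatible σ f} => ∑ i, f.1 i) = X ^ maj σ * antitoneGF n := by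
  rw [antitoneGF, ← gf_shift]
  refine gf_equiv ⟨fun f => ⟨_, (antitone_sub_descentsAfter f.2).2⟩,
    fun f => ⟨_, compatible_add_descentsAfter σ f.2⟩, fun f => ?_, fun f => ?_⟩ fun f => ?_
  · apply Subtype.ext
    funext i
    exact Nat.sub_add_cancel ((antitone_sub_descentsAfter f.2).1 i)
  · apply Subtype.ext
    funext i
    exact Nat.add_sub_cancel (f.1 i) (descentsAfter σ i)
  · rw [← sum_descentsAfter, ← Finset.sum_add_distrib]
    refine Finset.sum_congr rfl fun i _ => ?_
    exact Nat.sub_add_cancel ((antitone_sub_descentsAfter f.2).1 i)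

/-! ### Wachs's recurrence -/

lemma unbalancedGF_eq (n : ℕ) : unbalancedGF n = (d n : ℤ⟦X⟧) * antitoneGF n := by
  rw [unbalancedGF_eq_sum, d]
  simp_rw [gf_compatible]
  rw [← Finset.sum_mul]
  congr 1
  rw [← Polynomial.coeToPowerSeries.ringHom_apply, map_sum]
  simp

lemma mk_one_mul_one_sub (n : ℕ) :
    (PowerSeries.mk 1 : ℤ⟦X⟧) * (1 - X ^ n) = ∑ i ∈ Finset.range n, X ^ i := by
  rw [← mul_neg_geom_sum, ← mul_assoc, PowerSeries.mk_one_mul_one_sub_eq_one, one_mul]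

/-- **Wachs's recurrence** for the `q`-derangement numbers. -/
theorem d_succ (n : ℕ) : d (n + 1) =
    (∑ i ∈ Finset.range (n + 1), Polynomial.X ^ i) * d n +
      (-1) ^ (n + 1) * Polynomial.X ^ (n + 1).choose 2 := by
  have h := unbalancedGF_succ n
  rw [unbalancedGF_eq, unbalancedGF_eq] at h
  have h1 := antitoneGF_succ n
  have h2 := mk_one_mul_one_sub (n + 1)
  have h3 : antitoneGF (n + 1) ≠ 0 := by
    intro h0
    have h4 : ∀ m, antitoneGF m ≠ 0 → antitoneGF (m + 1) ≠ 0 := by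
      intro m hm h0
      have := antitoneGF_succ m
      rw [h0] at this
      simp at this
      exact hm this.symm
    have h5 : ∀ m, antitoneGF m ≠ 0 := fun m => by
      induction m with
      | zero => rw [antitoneGF_zero]; exact one_ne_zero
      | succ m ih => exact h4 m ih
    exact h5 _ h0
  apply Polynomial.coe_injective (R := ℤ)
  apply mul_right_cancel₀ h3
  have h6 : ((∑ i ∈ Finset.range (n + 1), Polynomial.X ^ i : Polynomial ℤ) : ℤ⟦X⟧) =
      ∑ i ∈ Finset.range (n + 1), X ^ i := by
    rw [← Polynomial.coeToPowerSeries.ringHom_apply, map_sum]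
    simp
  push_cast
  rw [h, h6, ← h2]
  -- Uses `antitoneGF n = (1 - X ^ (n + 1)) * antitoneGF (n + 1)`, whose factor turns `1 / (1 - X)`
  -- into the finite geometric sum.
  linear_combination (-1 : ℤ⟦X⟧) * PowerSeries.mk 1 * (d n : ℤ⟦X⟧) * h1

end QDerangement
-- Minors of a sequence against its reversal
namespace QDerangement

/-- The sum of `w` consecutive terms of `a`, the last one having index `z`. -/
def window (w : ℕ) (a : ℤ → ℚ) (z : ℤ) : ℚ := ∑ t ∈ Finset.range w, a (z - t)

/-- The minor in columns `p`, `q` of the two-rowed matrix formed by `a` and its reversal. -/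
def minor (a : ℤ → ℚ) (K p q : ℤ) : ℚ := a p * a (K - q) - a q * a (K - p)

lemma minor_mirror (a : ℤ → ℚ) (K p q : ℤ) : minor a K (K - q) (K - p) = minor a K p q := by
  simp only [minor, sub_sub_cancel]
  ring

lemma window_eq_reflect (s : ℕ) (a : ℤ → ℚ) (z : ℤ) :
    window (s + 1) a (z + s) = ∑ t ∈ Finset.range (s + 1), a (z + t) := by
  rw [window, ← Finset.sum_range_reflect]
  refine Finset.sum_congr rfl fun t ht => ?_
  congr 1
  have := Finset.mem_range.1 ht
  rw [Nat.cast_sub (by omega)]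
  push_cast
  omega

/-- A consecutive minor of the window sums is a sum of minors of the original sequence. -/
lemma minor_window (s : ℕ) (a : ℤ → ℚ) (K i : ℤ) :
    minor (window (s + 1) a) (K + s) i (i + 1) =
      ∑ t ∈ Finset.range (s + 1), minor a K (i - t) (i + 1) +
      ∑ t ∈ Finset.range s, minor a K (K - i - 1 + s - t) (K - i - 1 + s + 1) := by
  -- Consecutive windows share `s` terms, in the sequence and in its reversal; the product of the
  -- shared sums cancels in the minor, and the rest regroups into the two sums.
  have r : ∀ z : ℤ, ∑ t ∈ Finset.range s, a (z + s - 1 - t) = ∑ t ∈ Finset.range s, a (z + t) := by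
    intro z
    rw [← Finset.sum_range_reflect]
    refine Finset.sum_congr rfl fun t ht => ?_
    congr 1
    have := Finset.mem_range.1 ht
    rw [Nat.cast_sub (by omega), Nat.cast_sub (by omega)]
    push_cast
    omega
  have h1 : window (s + 1) a i = ∑ t ∈ Finset.range s, a (i - t) + a (i - s) := by
    rw [window, Finset.sum_range_succ]
  have h2 : window (s + 1) a (i + 1) = ∑ t ∈ Finset.range s, a (i - t) + a (i + 1) := by
    rw [window, Finset.sum_range_succ']
    simp
  have h3 : window (s + 1) a (K + s - i) =
      ∑ t ∈ Finset.range s, a (K - i + t) + a (K - i + s) := by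
    rw [show K + s - i = (K - i) + s by ring, window_eq_reflect, Finset.sum_range_succ]
  have h4 : window (s + 1) a (K + s - (i + 1)) =
      ∑ t ∈ Finset.range s, a (K - i + t) + a (K - i - 1) := by
    rw [show K + s - (i + 1) = (K - i - 1) + s by ring, window_eq_reflect, Finset.sum_range_succ']
    push_cast
    rw [add_zero]
    congr 1
    exact Finset.sum_congr rfl fun t _ => by congr 1; ring
  have h5 : ∑ t ∈ Finset.range (s + 1), minor a K (i - t) (i + 1) =
      (∑ t ∈ Finset.range s, a (i - t) + a (i - s)) * a (K - i - 1) -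
        a (i + 1) * (∑ t ∈ Finset.range s, a (K - i + t) + a (K - i + s)) := by
    rw [← Finset.sum_range_succ (fun t : ℕ => a (i - t)),
      ← Finset.sum_range_succ (fun t : ℕ => a (K - i + t)), Finset.sum_mul, Finset.mul_sum,
      ← Finset.sum_sub_distrib]
    refine Finset.sum_congr rfl fun t _ => ?_
    rw [minor, show K - (i + 1) = K - i - 1 by ring, show K - (i - t) = K - i + t by ring]
  have h6 : ∑ t ∈ Finset.range s, minor a K (K - i - 1 + s - t) (K - i - 1 + s + 1) =
      (∑ t ∈ Finset.range s, a (K - i + t)) * a (i - s) -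
        a (K - i + s) * (∑ t ∈ Finset.range s, a (i - t)) := by
    have r1 := r (K - i)
    have r2 := r (i - s + 1)
    rw [← r1]
    have r3 : ∑ t ∈ Finset.range s, a (i - t) = ∑ t ∈ Finset.range s, a (i - s + 1 + t) := by
      rw [← r2]
      exact Finset.sum_congr rfl fun t _ => by congr 1; ring
    rw [r3, Finset.sum_mul, Finset.mul_sum, ← Finset.sum_sub_distrib]
    refine Finset.sum_congr rfl fun t _ => ?_
    rw [minor, show K - (K - i - 1 + s + 1) = i - s by ring,
      show K - (K - i - 1 + s - t) = i - s + 1 + t by ring,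
      show K - i - 1 + s + 1 = K - i + s by ring, show K - i - 1 + s - t = K - i + s - 1 - t by ring]
  rw [h5, h6, minor, h1, h2, h3, h4]
  ring

lemma minor_pos_of_consecutive {a : ℤ → ℚ} {ε : ℚ} {lo hi : ℤ}
    (hpos : ∀ z, lo ≤ z → z ≤ hi → 0 < a z)
    (h : ∀ i, lo ≤ i → i + 1 ≤ hi → 0 < ε * minor a (lo + hi) i (i + 1)) (p q : ℤ) (hp : lo ≤ p)
    (hpq : p < q) (hq : q ≤ hi) : 0 < ε * minor a (lo + hi) p q := by
  induction q, (show p + 1 ≤ q from hpq) using Int.leInduction with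
  | base => exact h p hp hq
  | succ q hpq' ih =>
    have h1 := ih (by omega) (by omega)
    have h2 := h q (by omega) hq
    have p1 := hpos q (by omega) (by omega)
    have p2 := hpos (lo + hi - q) (by omega) (by omega)
    have p3 := hpos (lo + hi - p) (by omega) (by omega)
    have p4 := hpos (lo + hi - (q + 1)) (by omega) (by omega)
    -- The three-term relation between minors in columns `p`, `q`, `q + 1`.
    have h3 : a (lo + hi - q) * (ε * minor a (lo + hi) p (q + 1)) =
        a (lo + hi - (q + 1)) * (ε * minor a (lo + hi) p q) +
          a (lo + hi - p) * (ε * minor a (lo + hi) q (q + 1)) := by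
      simp only [minor]
      ring
    exact pos_of_mul_pos_right (h3 ▸ add_pos (mul_pos p4 h1) (mul_pos p3 h2)) p2.le

/-- Multiplication by `1 + X + ⋯ + X ^ s` preserves the sign of the consecutive minors, provided
that the sums of minors with a common right column have that sign. -/
lemma minor_window_pos {a : ℤ → ℚ} {ε : ℚ} {lo hi : ℤ} {s : ℕ} (hs : lo + s ≤ hi)
    (h0 : ∀ v : ℕ, s ≤ v → ∀ i, 0 ≤ ε * ∑ t ∈ Finset.range v, minor a (lo + hi) (i - t) (i + 1))
    (h1 : ∀ v : ℕ, s ≤ v → ∀ i, lo ≤ i → i + 1 ≤ hi →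
      0 < ε * ∑ t ∈ Finset.range v, minor a (lo + hi) (i - t) (i + 1))
    (i : ℤ) (hi1 : lo ≤ i) (hi2 : i + 1 ≤ hi + s) :
    0 < ε * minor (window (s + 1) a) (lo + (hi + s)) i (i + 1) := by
  rw [← add_assoc, minor_window, mul_add]
  -- One of the two sums of `minor_window` always has its right column in range; for large `i` it is
  -- the second, because `lo + s ≤ hi`.
  by_cases h : i + 1 ≤ hi
  · exact add_pos_of_pos_of_nonneg (h1 _ (by omega) i hi1 h) (h0 _ le_rfl _)
  · exact add_pos_of_nonneg_of_pos (h0 _ (by omega) i) (h1 _ le_rfl _ (by omega) (by omega))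

/-! ### Ratio monotonicity and multiplication by a geometric sum -/

/-- Ratio monotonicity of the positive sequence `a 1, …, a L`. -/
structure RatioMonotone (L : ℤ) (a : ℤ → ℚ) : Prop where
  pos : ∀ z, 1 ≤ z → z ≤ L → 0 < a z
  zero : ∀ z, z < 1 ∨ L < z → a z = 0
  lower : ∀ p q, 1 ≤ p → p < q → q ≤ L → 0 < (-1) * minor a (1 + L) p q
  upper : ∀ p q, 2 ≤ p → p < q → q ≤ L → 0 < 1 * minor a (2 + L) p q

lemma nonneg_of_support {L : ℤ} {a : ℤ → ℚ} (pos : ∀ z, 1 ≤ z → z ≤ L → 0 < a z)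
    (zero : ∀ z, z < 1 ∨ L < z → a z = 0) (z : ℤ) : 0 ≤ a z := by
  by_cases h : z < 1 ∨ L < z
  · exact (zero z h).ge
  · push Not at h
    exact (pos z h.1 h.2).le

/-- Outside the range, the product entering with the unfavourable sign has a factor off the support.
-/
lemma lower_nonneg {L : ℤ} {a : ℤ → ℚ} (zero : ∀ z, z < 1 ∨ L < z → a z = 0)
    (nonneg : ∀ z, 0 ≤ a z) {p q : ℤ} (h : ¬ (1 ≤ p ∧ q ≤ L)) :
    0 ≤ (-1) * minor a (1 + L) p q := by
  have : a p * a (1 + L - q) = 0 := by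
    by_cases h1 : p < 1
    · rw [zero p (Or.inl h1), zero_mul]
    · rw [zero (1 + L - q) (Or.inl (by omega)), mul_zero]
  rw [minor, this]
  have := mul_nonneg (nonneg q) (nonneg (1 + L - p))
  linarith

lemma upper_nonneg {L : ℤ} {a : ℤ → ℚ} (zero : ∀ z, z < 1 ∨ L < z → a z = 0)
    (nonneg : ∀ z, 0 ≤ a z) {p q : ℤ} (h : ¬ (2 ≤ p ∧ q ≤ L)) :
    0 ≤ 1 * minor a (2 + L) p q := by
  have : a q * a (2 + L - p) = 0 := by
    by_cases h1 : L < q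
    · rw [zero q (Or.inr h1), zero_mul]
    · rw [zero (2 + L - p) (Or.inr (by omega)), mul_zero]
  rw [minor, this]
  have := mul_nonneg (nonneg p) (nonneg (2 + L - q))
  linarith

lemma window_pos {L : ℤ} {a : ℤ → ℚ} {s : ℕ} (pos : ∀ z, 1 ≤ z → z ≤ L → 0 < a z)
    (zero : ∀ z, z < 1 ∨ L < z → a z = 0) (hs : s + 1 ≤ L) (z : ℤ) (h1 : 1 ≤ z)
    (h2 : z ≤ L + s) : 0 < window (s + 1) a z := by
  refine Finset.sum_pos' (fun t _ => nonneg_of_support pos zero _) ?_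
  by_cases h : z ≤ L
  · exact ⟨0, by simp, by simpa using pos z h1 h⟩
  · refine ⟨(z - L).toNat, by simp; omega, pos _ ?_ ?_⟩ <;> omega

lemma window_zero {L : ℤ} {a : ℤ → ℚ} {s : ℕ} (zero : ∀ z, z < 1 ∨ L < z → a z = 0) (z : ℤ)
    (h : z < 1 ∨ L + s < z) : window (s + 1) a z = 0 :=
  Finset.sum_eq_zero fun t ht => zero _ (by
    have := Finset.mem_range.1 ht
    omega)

lemma sum_nonneg_of_forall {ε : ℚ} {v : ℕ} {f : ℕ → ℚ} (h : ∀ t, 0 ≤ ε * f t) :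
    0 ≤ ε * ∑ t ∈ Finset.range v, f t := by
  rw [Finset.mul_sum]
  exact Finset.sum_nonneg fun t _ => h t

lemma sum_pos_of_head {ε : ℚ} {v : ℕ} (hv : 1 ≤ v) {f : ℕ → ℚ} (h : ∀ t, 0 ≤ ε * f t)
    (h0 : 0 < ε * f 0) : 0 < ε * ∑ t ∈ Finset.range v, f t := by
  rw [Finset.mul_sum]
  exact Finset.sum_pos' (fun t _ => h t) ⟨0, Finset.mem_range.2 hv, h0⟩

lemma window_lower {L : ℤ} {a : ℤ → ℚ} {s : ℕ} (pos : ∀ z, 1 ≤ z → z ≤ L → 0 < a z)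
    (zero : ∀ z, z < 1 ∨ L < z → a z = 0)
    (lower : ∀ p q, 1 ≤ p → p < q → q ≤ L → 0 < (-1) * minor a (1 + L) p q)
    (hs1 : 1 ≤ s) (hs : s + 1 ≤ L) (p q : ℤ) (hp : 1 ≤ p) (hpq : p < q) (hq : q ≤ L + s) :
    0 < (-1) * minor (window (s + 1) a) (1 + (L + s)) p q := by
  have weak : ∀ p q, p < q → 0 ≤ (-1) * minor a (1 + L) p q := fun p q hpq => by
    by_cases h : 1 ≤ p ∧ q ≤ L
    · exact (lower p q h.1 hpq h.2).le
    · exact lower_nonneg zero (nonneg_of_support pos zero) h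
  refine minor_pos_of_consecutive (window_pos pos zero hs)
    (minor_window_pos (by omega) ?_ ?_) p q hp hpq hq
  · exact fun v _ i => sum_nonneg_of_forall fun t => weak _ _ (by omega)
  · exact fun v hv i hi1 hi2 => sum_pos_of_head (by omega) (fun t => weak _ _ (by omega))
      (lower _ _ (by simpa using hi1) (by omega) hi2)

lemma RatioMonotone.window {L : ℤ} {a : ℤ → ℚ} (h : RatioMonotone L a) {s : ℕ} (hs1 : 1 ≤ s)
    (hs : s + 2 ≤ L) : RatioMonotone (L + s) (window (s + 1) a) := by
  have weak : ∀ p q, p < q → 0 ≤ 1 * minor a (2 + L) p q := fun p q hpq => by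
    by_cases h' : 2 ≤ p ∧ q ≤ L
    · exact (h.upper p q h'.1 hpq h'.2).le
    · exact upper_nonneg h.zero (nonneg_of_support h.pos h.zero) h'
  refine ⟨window_pos h.pos h.zero (by omega), window_zero h.zero,
    window_lower h.pos h.zero h.lower hs1 (by omega), fun p q hp hpq hq => ?_⟩
  refine minor_pos_of_consecutive
    (fun z h1 h2 => window_pos h.pos h.zero (by omega) z (by omega) h2)
    (minor_window_pos (by omega) ?_ ?_) p q hp hpq hq
  · exact fun v _ i => sum_nonneg_of_forall fun t => weak _ _ (by omega)
  · exact fun v hv i hi1 hi2 => sum_pos_of_head (by omega) (fun t => weak _ _ (by omega))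
      (h.upper _ _ (by simpa using hi1) (by omega) hi2)

/-- For columns symmetric under the reflection the minor is a difference of two squares. -/
lemma RatioMonotone.lt_reflect {L : ℤ} {a : ℤ → ℚ} (h : RatioMonotone L a) {p : ℤ} (hp : 1 ≤ p)
    (hpq : p < L + 1 - p) : a p < a (L + 1 - p) := by
  have h1 := h.lower p (L + 1 - p) hp hpq (by omega)
  rw [minor, show 1 + L - (L + 1 - p) = p by ring, show 1 + L - p = L + 1 - p by ring] at h1
  exact lt_of_mul_self_lt_mul_self₀ (h.pos _ (by omega) (by omega)).le (by linarith)

lemma RatioMonotone.reflect_lt {L : ℤ} {a : ℤ → ℚ} (h : RatioMonotone L a) {p : ℤ} (hp : 1 ≤ p)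
    (hpq : p + 1 < L + 1 - p) : a (L + 1 - p) < a (p + 1) := by
  have h1 := h.upper (p + 1) (L + 1 - p) (by omega) hpq (by omega)
  rw [minor, show 2 + L - (L + 1 - p) = p + 1 by ring,
    show 2 + L - (p + 1) = L + 1 - p by ring] at h1
  exact lt_of_mul_self_lt_mul_self₀ (h.pos _ (by omega) (by omega)).le (by linarith)

lemma RatioMonotone.lt_succ {L : ℤ} {a : ℤ → ℚ} (h : RatioMonotone L a) {p : ℤ} (hp : 1 ≤ p)
    (hpL : 2 * p ≤ L) : a p < a (p + 1) := by
  have h1 := h.lt_reflect hp (by omega)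
  by_cases h2 : p + 1 = L + 1 - p
  · rwa [← h2] at h1
  · exact h1.trans (h.reflect_lt hp (by omega))

lemma window_add_one (s : ℕ) (a : ℤ → ℚ) (z : ℤ) :
    window (s + 1) a (z + 1) = window (s + 1) a z + a (z + 1) - a (z - s) := by
  rw [window, window, Finset.sum_range_succ', Finset.sum_range_succ]
  simp
  ring

lemma consecutive_of_half {a : ℤ → ℚ} {ε : ℚ} {lo hi : ℤ}
    (h : ∀ i, lo ≤ i → 2 * i + 1 ≤ lo + hi → 0 < ε * minor a (lo + hi) i (i + 1)) (i : ℤ)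
    (h1 : lo ≤ i) (h2 : i + 1 ≤ hi) : 0 < ε * minor a (lo + hi) i (i + 1) := by
  by_cases hi3 : 2 * i + 1 ≤ lo + hi
  · exact h i h1 hi3
  · have := h (lo + hi - (i + 1)) (by omega) (by omega)
    rwa [show lo + hi - (i + 1) + 1 = lo + hi - i by ring, minor_mirror] at this

/-! ### Adding one to the top coefficients -/

/-- Add one to the `N` terms following the term with index `L`. -/
def addTail (L N : ℤ) (a : ℤ → ℚ) (z : ℤ) : ℚ := a z + if L < z ∧ z ≤ L + N then 1 else 0

/-- Ratio monotonicity is preserved by multiplication by `1 + X + ⋯ + X ^ N` and addition of one to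
the last `N` terms. -/
lemma RatioMonotone.addTail_window {L : ℤ} {N : ℕ} {a : ℤ → ℚ} (h : RatioMonotone L a)
    (hN : 3 ≤ N) (hL : 2 * N + 2 ≤ L) (h1 : a 1 = 1) (ha2 : a 2 ≤ 2 * a L)
    (h2 : (1 + a L) * a 3 < a (L - 1) * (1 + a 2))
    (h4 : (1 + a L + a (L - 1) + a (L - 2) + N / 2) * a 5 <
      a (L - 3) * (1 + a 2 + a 3 + a 4)) :
    RatioMonotone (L + N) (addTail L N (QDerangement.window (N + 1) a)) := by
  have hb := h.window (s := N) (by omega) (by omega)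
  set b := QDerangement.window (N + 1) a with hbdef
  set e := addTail L N b with he
  have e_low : ∀ z, z ≤ L → e z = b z := fun z hz => by
    rw [he, addTail, if_neg (by omega), add_zero]
  have e_high : ∀ z, L < z → z ≤ L + N → e z = b z + 1 := fun z hz hz' => by
    rw [he, addTail, if_pos ⟨hz, hz'⟩]
  have le_e : ∀ z, b z ≤ e z := fun z => by
    rw [he, addTail]
    split_ifs <;> simp
  have pos : ∀ z, 1 ≤ z → z ≤ L + N → 0 < e z := fun z hz hz' =>
    (hb.pos z hz hz').trans_le (le_e z)
  refine ⟨pos, fun z hz => ?_, minor_pos_of_consecutive pos (consecutive_of_half ?_),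
    minor_pos_of_consecutive (fun z hz hz' => pos z (by omega) hz') (consecutive_of_half ?_)⟩
  · rw [he, addTail, hb.zero z hz, if_neg (by omega), add_zero]
  · intro i hi hi2
    have k1 := hb.lower i (i + 1) hi (by omega) (by omega)
    have k2 := hb.lt_succ hi (by omega)
    rw [minor] at k1 ⊢
    rw [e_low i (by omega), e_low (i + 1) (by omega)]
    -- The added ones only help here: the minor changes by `b i - b (i + 1)`, then by `-b (i + 1)`
    -- at `i = N`, then not at all.
    by_cases c1 : i ≤ N
    · rw [e_high (1 + (L + N) - i) (by omega) (by omega)]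
      by_cases c2 : i + 1 ≤ N
      · rw [e_high (1 + (L + N) - (i + 1)) (by omega) (by omega)]
        linarith
      · rw [e_low (1 + (L + N) - (i + 1)) (by omega)]
        have := hb.pos (i + 1) (by omega) (by omega)
        linarith
    · rw [e_low (1 + (L + N) - i) (by omega), e_low (1 + (L + N) - (i + 1)) (by omega)]
      linarith
  · intro i hi hi2
    have k1 := hb.upper i (i + 1) hi (by omega) (by omega)
    rw [minor] at k1 ⊢
    rw [e_low i (by omega), e_low (i + 1) (by omega)]
    by_cases c0 : N + 1 < i
    · rw [e_low (2 + (L + N) - i) (by omega), e_low (2 + (L + N) - (i + 1)) (by omega)]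
      exact k1
    have b_succ : ∀ j : ℤ, j ≤ N → b (j + 1) = b j + a (j + 1) := fun j hj => by
      rw [hbdef, window_add_one, h.zero (j - N) (by omega), sub_zero]
    have b_top : ∀ j : ℤ, j ≤ N + 1 →
        b (2 + (L + N) - (j + 1)) = b (2 + (L + N) - j) + a (L + 1 - j) := fun j hj => by
      have := window_add_one N a (2 + (L + N) - (j + 1))
      rw [show 2 + (L + N) - (j + 1) + 1 = 2 + (L + N) - j by ring,
        h.zero (2 + (L + N) - j) (by omega),
        show 2 + (L + N) - (j + 1) - N = L + 1 - j by ring, ← hbdef] at this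
      linarith
    have b1 : b 1 = 1 := by
      have := b_succ 0 (by omega)
      rw [zero_add, hb.zero 0 (by omega), h1] at this
      rw [this, zero_add]
    have t1 : b (2 + (L + N) - 1) = 0 := hb.zero _ (by omega)
    have b2 : b 2 = 1 + a 2 := by rw [← b1]; exact b_succ 1 (by omega)
    have b3 : b 3 = b 2 + a 3 := b_succ 2 (by omega)
    have b4 : b 4 = b 3 + a 4 := b_succ 3 (by omega)
    have t2 : b (2 + (L + N) - 2) = a L := by
      have := b_top 1 (by omega)
      rw [t1, zero_add, show L + 1 - 1 = L by ring] at this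
      exact this
    have t3 : b (2 + (L + N) - 3) = a L + a (L - 1) := by
      have := b_top 2 (by omega)
      rw [t2, show L + 1 - 2 = L - 1 by ring] at this
      exact this
    have t4 : b (2 + (L + N) - 4) = a L + a (L - 1) + a (L - 2) := by
      have := b_top 3 (by omega)
      rw [t3, show L + 1 - 3 = L - 2 by ring] at this
      exact this
    -- The inequality with slack `c` propagates to the right.
    have prop : ∀ (c : ℚ) (j₀ : ℤ), 0 ≤ c → 2 ≤ j₀ →
        (b (2 + (L + N) - j₀) + 1 + c) * a (j₀ + 1) < a (L + 1 - j₀) * b j₀ → ∀ j, j₀ ≤ j →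
        j ≤ N + 1 → (b (2 + (L + N) - j) + 1 + c) * a (j + 1) < a (L + 1 - j) * b j := by
      intro c j₀ hc hj₀ hbase j hj
      induction j, hj using Int.leInduction with
      | base => exact fun _ => hbase
      | succ j hj ih =>
        intro hjN
        have ih := ih (by omega)
        have m := h.upper (j + 1) (j + 1 + 1) (by omega) (by omega) (by omega)
        rw [minor, show 2 + L - (j + 1 + 1) = L + 1 - (j + 1) by ring,
          show 2 + L - (j + 1) = L + 1 - j by ring] at m
        rw [b_top j (by omega), b_succ j (by omega)]
        have p1 := h.pos (j + 1) (by omega) (by omega)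
        have p2 := h.pos (j + 1 + 1) (by omega) (by omega)
        have p3 := hb.pos j (by omega) (by omega)
        have q1 := mul_lt_mul_of_pos_right ih p2
        have q2 := mul_pos p3 (show 0 < a (j + 1) * a (L + 1 - (j + 1)) -
          a (j + 1 + 1) * a (L + 1 - j) by linarith)
        refine lt_of_mul_lt_mul_right ?_ p1.le
        nlinarith
    by_cases c1 : i ≤ N
    -- After cancellation the new minor is `b i * a (L + 1 - i) - (b (2 + L + N - i) + 1) * a (i +
    -- 1)`, so zero slack suffices.
    · have k3 := prop 0 2 le_rfl le_rfl (by
        rw [t2, b2, add_zero, add_comm (a L), show L + 1 - 2 = L - 1 by ring]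
        exact h2) i hi (by omega)
      rw [e_high _ (by omega) (by omega), e_high _ (by omega) (by omega), b_top i (by omega),
        b_succ i (by omega)]
      linarith
    -- At the edge of the block only one factor gains 1, which costs `b (N + 1) - b (L + 1) - 1`.
    -- Slack `N / 2` pays for it; the propagation starts at 4 because for `core 6` this slack is
    -- still too large at 2 and 3.
    · obtain rfl : i = N + 1 := by omega
      have k3 := prop (N / 2) 4 (by positivity) (by omega) (by
        rw [t4, b4, b3, b2, show L + 1 - 4 = L - 3 by ring, show (4 : ℤ) + 1 = 5 by norm_num]
        linarith) (N + 1) (by omega) le_rfl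
      -- Each step adds `a (j + 1) - a (L + 1 - j)`, at most half of `a (j + 1)` by `m2` below;
      -- since `a` increases here, the total is at most `(j - 1) / 2 * a j`.
      have k4 : ∀ j : ℤ, 1 ≤ j → j ≤ N + 1 →
          b j - b (2 + (L + N) - j) - 1 ≤ (j - 1) / 2 * a j := by
        intro j hj
        induction j, hj using Int.leInduction with
        | base => intro _; rw [b1, t1]; simp
        | succ j hj ih =>
          intro hjN
          have ih := ih (by omega)
          rw [b_top j (by omega), b_succ j (by omega)]
          have m1 := h.lt_succ hj (by omega)
          have hj' : (0 : ℚ) ≤ j - 1 := by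
            have : (1 : ℚ) ≤ j := by exact_mod_cast hj
            linarith
          have m2 : a (j + 1) ≤ 2 * a (L + 1 - j) := by
            rcases hj.lt_or_eq with hlt | rfl
            · have m := h.upper 2 (j + 1) le_rfl (by omega) (by omega)
              rw [minor, show 2 + L - (j + 1) = L + 1 - j by ring,
                show 2 + L - 2 = L by ring] at m
              have p1 := h.pos L (by omega) le_rfl
              have p2 := h.pos (L + 1 - j) (by omega) (by omega)
              nlinarith
            · simpa using ha2
          have m3 := mul_le_mul_of_nonneg_left m1.le hj'
          push_cast
          linarith
      have k5 := k4 (N + 1) (by omega) le_rfl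
      have k6 := h.lt_succ (p := N + 1) (by omega) (by omega)
      have k7 : (0 : ℚ) ≤ N := by positivity
      have k8 := mul_le_mul_of_nonneg_left k6.le k7
      have k9 : b (N + 1 + 1) = b (N + 1) + a (N + 1 + 1) - 1 := by
        rw [hbdef, window_add_one, show (N : ℤ) + 1 - N = 1 by ring, h1]
      rw [e_high (2 + (L + N) - (N + 1)) (by omega) (by omega),
        e_low (2 + (L + N) - (N + 1 + 1)) (by omega), b_top (N + 1) le_rfl, k9]
      push_cast at k5
      nlinarith

/-! ### From polynomials to coefficient sequences -/

/-- The coefficient sequence of a polynomial, extended by zero to negative indices. -/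
noncomputable def coeffSeq (p : Polynomial ℤ) (z : ℤ) : ℚ :=
  if z < 0 then 0 else (p.coeff z.toNat : ℚ)

lemma coeffSeq_natCast (p : Polynomial ℤ) (k : ℕ) : coeffSeq p k = (p.coeff k : ℚ) := by
  simp [coeffSeq]

lemma coeffSeq_add (p q : Polynomial ℤ) (z : ℤ) :
    coeffSeq (p + q) z = coeffSeq p z + coeffSeq q z := by
  rw [coeffSeq, coeffSeq, coeffSeq]
  split_ifs <;> simp

lemma coeffSeq_X_pow (m : ℕ) (z : ℤ) :
    coeffSeq (Polynomial.X ^ m) z = if z = m then 1 else 0 := by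
  rw [coeffSeq, Polynomial.coeff_X_pow]
  split_ifs <;> first | omega | simp

lemma coeffSeq_geom_mul (w : ℕ) (p : Polynomial ℤ) :
    coeffSeq ((∑ i ∈ Finset.range w, Polynomial.X ^ i) * p) = window w (coeffSeq p) := by
  funext z
  rw [window, coeffSeq, Finset.sum_mul, Polynomial.finsetSum_coeff]
  split_ifs with hz
  · refine (Finset.sum_eq_zero fun t _ => ?_).symm
    rw [coeffSeq, if_pos (by omega)]
  · push_cast
    refine Finset.sum_congr rfl fun t _ => ?_
    rw [coeffSeq, Polynomial.coeff_X_pow_mul']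
    split_ifs with h1 h2 h2
    · omega
    · congr 2
      omega
    · simp
    · omega

lemma coeffSeq_add_geom_mul_X_pow (p : Polynomial ℤ) (N m : ℕ) :
    coeffSeq (p + (∑ i ∈ Finset.range N, Polynomial.X ^ i) * Polynomial.X ^ m) =
      addTail (m - 1) N (coeffSeq p) := by
  funext z
  rw [coeffSeq_add, addTail, coeffSeq_geom_mul, window]
  congr 1
  simp only [coeffSeq_X_pow]
  split_ifs with h
  · rw [Finset.sum_eq_single_of_mem (z - m).toNat (Finset.mem_range.2 (by omega)),
      if_pos (by omega)]
    intro t _ ht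
    rw [if_neg (by omega)]
  · refine Finset.sum_eq_zero fun t ht => ?_
    have := Finset.mem_range.1 ht
    rw [if_neg (by omega)]

lemma window_low {L : ℤ} {a : ℤ → ℚ} (zero : ∀ z, z < 1 ∨ L < z → a z = 0) {s : ℕ} (n : ℕ)
    (hn : n ≤ s + 1) : window (s + 1) a n = ∑ t ∈ Finset.range n, a (t + 1) := by
  obtain ⟨u, hu⟩ := Nat.exists_eq_add_of_le hn
  rw [window, hu, Finset.sum_range_add,
    Finset.sum_eq_zero (s := Finset.range u) fun t _ => zero _ (by push_cast; omega), add_zero,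
    ← Finset.sum_range_reflect]
  refine Finset.sum_congr rfl fun t ht => ?_
  have := Finset.mem_range.1 ht
  congr 1
  rw [Nat.cast_sub (by omega), Nat.cast_sub (by omega)]
  push_cast
  ring

lemma window_high {L : ℤ} {a : ℤ → ℚ} (zero : ∀ z, z < 1 ∨ L < z → a z = 0) {s : ℕ} (n : ℕ)
    (hn : n ≤ s) : window (s + 1) a (L + s - n) = ∑ t ∈ Finset.range (n + 1), a (L - t) := by
  obtain ⟨u, hu⟩ := Nat.exists_eq_add_of_le hn
  rw [add_sub_right_comm, window_eq_reflect, show s + 1 = n + 1 + u by omega, Finset.sum_range_add,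
    Finset.sum_eq_zero (s := Finset.range u) fun t _ => zero _ (by push_cast; omega), add_zero,
    ← Finset.sum_range_reflect]
  refine Finset.sum_congr rfl fun t ht => ?_
  have := Finset.mem_range.1 ht
  congr 1
  rw [Nat.cast_sub (by omega), Nat.cast_sub (by omega)]
  push_cast
  ring

lemma choose_two_even (k : ℕ) : (((2 * k).choose 2 : ℕ) : ℤ) = 2 * k ^ 2 - k := by
  rw [Nat.choose_two_right, mul_assoc, Nat.mul_div_cancel_left _ two_pos]
  rcases k with _ | k
  · simp
  · rw [Nat.cast_mul, Nat.cast_sub (by omega)]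
    push_cast
    ring

lemma d_zero : d 0 = 1 := by
  have : Unique (derangements (Fin 0)) :=
    { default := ⟨1, fun i => i.elim0⟩
      uniq := fun σ => Subtype.ext (Subsingleton.elim _ _) }
  simp [d, maj]

/-- The polynomial `d n` without its last term when `n` is even. -/
noncomputable def core (n : ℕ) : Polynomial ℤ :=
  if Even n then d n - Polynomial.X ^ n.choose 2 else d n

lemma core_even (k : ℕ) : core (2 * k) = d (2 * k) - Polynomial.X ^ (2 * k).choose 2 :=
  if_pos (even_two_mul k)

lemma core_odd (k : ℕ) : core (2 * k + 1) = d (2 * k + 1) :=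
  if_neg (Nat.not_even_two_mul_add_one k)

lemma core_succ_of_odd (k : ℕ) : core (2 * k + 2) =
    (∑ i ∈ Finset.range (2 * k + 2), Polynomial.X ^ i) * core (2 * k + 1) := by
  rw [core_odd, show 2 * k + 2 = 2 * (k + 1) by ring, core_even,
    show 2 * (k + 1) = 2 * k + 1 + 1 by ring, d_succ, Even.neg_one_pow ⟨k + 1, by ring⟩]
  ring

/-- The dropped term times `[2k+1]` is a block of `2k + 1` ones, whose last one is cancelled by the
correction term of `d_succ`. -/
lemma core_succ_of_even (k : ℕ) : core (2 * k + 1) =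
    (∑ i ∈ Finset.range (2 * k + 1), Polynomial.X ^ i) * core (2 * k) +
      (∑ i ∈ Finset.range (2 * k), Polynomial.X ^ i) * Polynomial.X ^ (2 * k).choose 2 := by
  rw [core_odd, core_even, d_succ, Odd.neg_one_pow ⟨k, rfl⟩, Nat.choose_succ_succ' (2 * k) 1,
    Nat.choose_one_right, Finset.sum_range_succ, pow_add]
  ring

lemma coeffSeq_core_odd (k : ℕ) : coeffSeq (core (2 * k + 1)) =
    addTail (2 * k ^ 2 - k - 1) (2 * k : ℕ)
      (window (2 * k + 1) (coeffSeq (core (2 * k)))) := by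
  rw [core_succ_of_even, coeffSeq_add_geom_mul_X_pow, coeffSeq_geom_mul, choose_two_even]

lemma coeffSeq_core_even (k : ℕ) : coeffSeq (core (2 * k + 2)) =
    window (2 * k + 2) (coeffSeq (core (2 * k + 1))) := by
  rw [core_succ_of_odd, coeffSeq_geom_mul]

/-! ### The induction over even indices -/

/-- The ratio monotonicity of the coefficients of `core (2 * k)`, with the values of the first and
last coefficients. -/
structure EvenInvariant (k : ℕ) (a : ℤ → ℚ) : Prop where
  mono : RatioMonotone (2 * k ^ 2 - k - 1) a
  one : a 1 = 1
  two : a 2 = 2 * k - 2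
  three : a 3 = 2 * k ^ 2 - 3 * k
  four : a 4 = (4 * k ^ 3 - 6 * k ^ 2 - 4 * k + 6) / 3
  five : a 5 = (4 * k ^ 4 - 4 * k ^ 3 - 13 * k ^ 2 + 19 * k - 12) / 6
  last : a (2 * k ^ 2 - k - 1) = k - 1
  last_sub_one : a (2 * k ^ 2 - k - 1 - 1) = k ^ 2 - k
  last_sub_two : a (2 * k ^ 2 - k - 1 - 2) = (4 * k ^ 3 - 3 * k ^ 2 - k - 6) / 6
  last_sub_three : a (2 * k ^ 2 - k - 1 - 3) = (k ^ 4 - k ^ 2 - 6 * k + 6) / 3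

lemma three_mul_le_sq {k : ℕ} (hk : 3 ≤ k) : (3 : ℤ) * k ≤ k ^ 2 := by
  have : (3 : ℤ) ≤ k := by exact_mod_cast hk
  nlinarith

lemma EvenInvariant.mono_succ {k : ℕ} (hk : 3 ≤ k) {a : ℤ → ℚ} (h : EvenInvariant k a) :
    RatioMonotone (2 * k ^ 2 + k - 1)
      (addTail (2 * k ^ 2 - k - 1) (2 * k : ℕ) (window (2 * k + 1) a)) := by
  obtain ⟨mono, v1, v2, v3, v4, v5, t0, t1, t2, t3⟩ := h
  have hkk := three_mul_le_sq hk
  -- In terms of `x = k - 3` the last required difference expands with nonnegative coefficients, so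
  -- `positivity` applies.
  obtain ⟨x, hx, rfl⟩ : ∃ x : ℕ, True ∧ k = x + 3 := ⟨k - 3, trivial, by omega⟩
  have hx0 : (0 : ℚ) ≤ x := by positivity
  have := mono.addTail_window (N := 2 * (x + 3)) (by omega) (by push_cast at *; linarith) v1
    (by rw [v2, t0]; linarith)
    (by
      rw [v2, v3, t0, t1]
      push_cast
      have : (0 : ℚ) ≤ x ^ 2 := by positivity
      nlinarith)
    (by
      rw [v2, v3, v4, v5, t0, t1, t2, t3]
      push_cast
      rw [← sub_pos]
      ring_nf
      positivity)
  convert this using 1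
  push_cast
  ring

lemma EvenInvariant.succ {k : ℕ} (hk : 3 ≤ k) {a : ℤ → ℚ} (h : EvenInvariant k a) :
    EvenInvariant (k + 1) (window (2 * k + 2)
      (addTail (2 * k ^ 2 - k - 1) (2 * k : ℕ) (window (2 * k + 1) a))) := by
  have mc := h.mono_succ hk
  obtain ⟨mono, v1, v2, v3, v4, v5, t0, t1, t2, t3⟩ := h
  have hkk := three_mul_le_sq hk
  have hkz : (3 : ℤ) ≤ k := by exact_mod_cast hk
  set L : ℤ := 2 * k ^ 2 - k - 1 with hL
  set b := window (2 * k + 1) a with hb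
  set c := addTail L (2 * k : ℕ) b with hc
  have hM : L + (2 * k : ℕ) = 2 * k ^ 2 + k - 1 := by rw [hL]; push_cast; ring
  rw [← hM] at mc
  have hL' : L + (2 * k : ℕ) + (2 * k + 1 : ℕ) =
      2 * ((k + 1 : ℕ) : ℤ) ^ 2 - (k + 1 : ℕ) - 1 := by
    rw [hM]; push_cast; ring
  have me := mc.window (s := 2 * k + 1) (by omega) (by rw [hM]; push_cast; omega)
  -- The extreme coefficients of a window are partial sums from that end, so five at the bottom and
  -- four at the top determine their successors; the top four lie inside the block of added ones.
  have low : ∀ n : ℕ, n ≤ 5 → c n = ∑ t ∈ Finset.range n, a (t + 1) := fun n hn => by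
    rw [hc, addTail, if_neg (by omega), add_zero, hb, window_low mono.zero n (by omega)]
  have high : ∀ n : ℕ, n ≤ 3 →
      c (L + (2 * k : ℕ) - n) = ∑ t ∈ Finset.range (n + 1), a (L - t) + 1 := fun n hn => by
    rw [hc, addTail, if_pos (by omega), hb, window_high mono.zero n (by omega)]
  have low' := window_low mc.zero (s := 2 * k + 1)
  have high' := window_high mc.zero (s := 2 * k + 1)
  have c1 := low 1 (by omega)
  have c2 := low 2 (by omega)
  have c3 := low 3 (by omega)
  have c4 := low 4 (by omega)
  have c5 := low 5 (by omega)
  have e0 := high 0 (by omega)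
  have e1 := high 1 (by omega)
  have e2 := high 2 (by omega)
  have e3 := high 3 (by omega)
  have d1 := low' 1 (by omega)
  have d2 := low' 2 (by omega)
  have d3 := low' 3 (by omega)
  have d4 := low' 4 (by omega)
  have d5 := low' 5 (by omega)
  have f0 := high' 0 (by omega)
  have f1 := high' 1 (by omega)
  have f2 := high' 2 (by omega)
  have f3 := high' 3 (by omega)
  norm_num only [Finset.sum_range_succ, Finset.sum_range_zero, Nat.cast_ofNat, Nat.cast_one,
    Nat.cast_zero, sub_zero, zero_add, v1, v2, v3, v4, v5, t0, t1, t2, t3] at c1 c2 c3 c4 c5 e0 e1 e2 e3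
  norm_num only [Finset.sum_range_succ, Finset.sum_range_zero, Nat.cast_ofNat, Nat.cast_one,
    Nat.cast_zero, sub_zero, zero_add, c1, c2, c3, c4, c5, e0, e1, e2, e3] at d1 d2 d3 d4 d5 f0 f1 f2 f3
  refine ⟨hL' ▸ me, d1, d2.trans ?_, d3.trans ?_, d4.trans ?_, d5.trans ?_,
    (hL' ▸ f0 :).trans ?_, (hL' ▸ f1 :).trans ?_, (hL' ▸ f2 :).trans ?_, (hL' ▸ f3 :).trans ?_⟩
  all_goals
    push_cast
    ring

/-! ### Small cases and the start of the induction -/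

lemma d_one : d 1 = 0 := by
  rw [d_succ, d_zero]
  simp

lemma d_two : d 2 = Polynomial.X := by
  rw [d_succ, d_one]
  norm_num

lemma d_three : d 3 = Polynomial.X + Polynomial.X ^ 2 := by
  rw [d_succ, d_two]
  norm_num [Finset.sum_range_succ, show Nat.choose 3 2 = 3 from rfl]
  ring

lemma d_four : d 4 = Polynomial.X + 2 * Polynomial.X ^ 2 + 2 * Polynomial.X ^ 3 +
    2 * Polynomial.X ^ 4 + Polynomial.X ^ 5 + Polynomial.X ^ 6 := by
  rw [d_succ, d_three]
  norm_num [Finset.sum_range_succ, show Nat.choose 4 2 = 6 from rfl]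
  ring

lemma d_five : d 5 = Polynomial.X + 3 * Polynomial.X ^ 2 + 5 * Polynomial.X ^ 3 +
    7 * Polynomial.X ^ 4 + 8 * Polynomial.X ^ 5 + 8 * Polynomial.X ^ 6 + 6 * Polynomial.X ^ 7 +
    4 * Polynomial.X ^ 8 + 2 * Polynomial.X ^ 9 := by
  rw [d_succ, d_four]
  norm_num [Finset.sum_range_succ, show Nat.choose 5 2 = 10 from rfl]
  ring

lemma core_six : core 6 = Polynomial.X + 4 * Polynomial.X ^ 2 + 9 * Polynomial.X ^ 3 +
    16 * Polynomial.X ^ 4 + 24 * Polynomial.X ^ 5 + 32 * Polynomial.X ^ 6 +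
    37 * Polynomial.X ^ 7 + 38 * Polynomial.X ^ 8 + 35 * Polynomial.X ^ 9 +
    28 * Polynomial.X ^ 10 + 20 * Polynomial.X ^ 11 + 12 * Polynomial.X ^ 12 +
    6 * Polynomial.X ^ 13 + 2 * Polynomial.X ^ 14 := by
  rw [core_succ_of_odd 2, core_odd 2, d_five]
  norm_num [Finset.sum_range_succ]
  ring

lemma coeff_core_six (k : ℕ) : (core 6).coeff k =
    [0, 1, 4, 9, 16, 24, 32, 37, 38, 35, 28, 20, 12, 6, 2].getD k 0 := by
  by_cases hk : k < 15
  · rw [core_six]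
    simp only [Polynomial.coeff_add, Polynomial.coeff_X]
    interval_cases k <;> simp
  · have hdeg : (core 6).natDegree ≤ 14 := by
      rw [core_six]
      compute_degree
    rw [List.getD_eq_default _ _ (by simp; omega)]
    exact Polynomial.coeff_eq_zero_of_natDegree_lt (by omega)

/-- The induction cannot start at `n = 5`: there the coefficients of degrees 5 and 6 are both 8, so
strictness fails. -/
lemma evenInvariant_six : EvenInvariant 3 (coeffSeq (core (2 * 3))) := by
  have val : ∀ k : ℕ, coeffSeq (core (2 * 3)) k =
      (([0, 1, 4, 9, 16, 24, 32, 37, 38, 35, 28, 20, 12, 6, 2].getD k 0 : ℤ) : ℚ) := fun k => by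
    rw [coeffSeq_natCast, ← coeff_core_six]
  have v1 := val 1
  have v2 := val 2
  have v3 := val 3
  have v4 := val 4
  have v5 := val 5
  have v6 := val 6
  have v7 := val 7
  have v8 := val 8
  have v9 := val 9
  have v10 := val 10
  have v11 := val 11
  have v12 := val 12
  have v13 := val 13
  have v14 := val 14
  have zero : ∀ z, z < 1 ∨ 14 < z → coeffSeq (core (2 * 3)) z = 0 := by
    rintro z (hz | hz)
    · rcases lt_or_eq_of_le (show z ≤ 0 by omega) with h | rfl
      · rw [coeffSeq, if_pos h]
      · exact (val 0).trans (by simp)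
    · lift z to ℕ using by omega
      rw [val, List.getD_eq_default _ _ (by simp; omega), Int.cast_zero]
  generalize coeffSeq (core (2 * 3)) = a at *
  simp only [Nat.cast_one, Nat.cast_ofNat, List.getD_cons_succ, List.getD_cons_zero, Int.cast_one,
    Int.cast_ofNat] at v1 v2 v3 v4 v5 v6 v7 v8 v9 v10 v11 v12 v13 v14
  have pos : ∀ z, 1 ≤ z → z ≤ 14 → 0 < a z := fun z h1 h2 => by
    interval_cases z <;> simp [v1, v2, v3, v4, v5, v6, v7, v8, v9, v10, v11, v12, v13, v14]
  refine ⟨?_, v1, ?_, ?_, ?_, ?_, ?_, ?_, ?_, ?_⟩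
  · norm_num
    refine ⟨pos, zero, minor_pos_of_consecutive pos (consecutive_of_half fun i h1 h2 => ?_),
      minor_pos_of_consecutive (fun z h1 h2 => pos z (by omega) h2)
        (consecutive_of_half fun i h1 h2 => ?_)⟩
    · have h3 : i ≤ 7 := by omega
      interval_cases i <;>
        norm_num [minor, v1, v2, v3, v4, v5, v6, v7, v8, v9, v10, v11, v12, v13, v14]
    · have h3 : i ≤ 7 := by omega
      interval_cases i <;>
        norm_num [minor, v1, v2, v3, v4, v5, v6, v7, v8, v9, v10, v11, v12, v13, v14]
  all_goals norm_num [v2, v3, v4, v5, v11, v12, v13, v14]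

lemma evenInvariant (k : ℕ) (hk : 3 ≤ k) : EvenInvariant k (coeffSeq (core (2 * k))) := by
  induction k, hk using Nat.le_induction with
  | base => exact evenInvariant_six
  | succ k hk ih =>
    have := ih.succ hk
    rwa [← coeffSeq_core_odd, ← coeffSeq_core_even] at this

/-- The ratio monotonicity of the `q`-derangement numbers. -/
theorem ratioMonotone_core (n : ℕ) (hn : 6 ≤ n) :
    RatioMonotone ((n.choose 2 - 1 : ℕ) : ℤ) (coeffSeq (core n)) := by
  have h1 : 1 ≤ n.choose 2 := Nat.choose_pos (by omega)
  rw [Nat.cast_sub h1]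
  obtain ⟨k, rfl | rfl⟩ := Nat.even_or_odd' n
  · rw [choose_two_even]
    exact_mod_cast (evenInvariant k (by omega)).mono
  · have := (evenInvariant k (by omega)).mono_succ (by omega)
    rw [← coeffSeq_core_odd] at this
    convert this using 1
    rw [Nat.choose_succ_succ' (2 * k) 1, Nat.choose_one_right, Nat.cast_add, choose_two_even]
    push_cast
    ring

/-! ### Ratio chains, spiral property and log-concavity -/

section Consequences

variable {L : ℕ} {a : ℤ → ℚ} {f : ℕ → ℚ}

lemma RatioMonotone.increasingBelowOne_lower (h : RatioMonotone L a)
    (hf : ∀ k : ℕ, k ≤ L → f k = a k) {b : ℕ} (hb : 1 ≤ b) (hbL : 2 * b ≤ L) :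
    IncreasingBelowOne (fun k => f k / f (L + 1 - k)) 1 b := by
  refine ⟨hb, fun k hk hkb => ?_, ?_⟩
  · have h1 := h.lower k (k + 1) (by omega) (by omega) (by omega)
    have p1 := h.pos (L + 1 - k) (by omega) (by omega)
    have p2 := h.pos (L - k) (by omega) (by omega)
    dsimp only
    rw [hf k (by omega), hf (k + 1) (by omega), hf (L + 1 - k) (by omega),
      hf (L + 1 - (k + 1)) (by omega), Nat.cast_sub (by omega), Nat.cast_sub (by omega)]
    rw [minor] at h1
    push_cast
    rw [show (1 : ℤ) + L - (k + 1) = L - k by ring, show (1 : ℤ) + L - k = L + 1 - k by ring] at h1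
    rw [show (L : ℤ) + 1 - (k + 1) = L - k by ring, div_lt_div_iff₀ p1 p2]
    linarith
  · have p1 := h.pos (L + 1 - b) (by omega) (by omega)
    have h1 := h.lt_reflect (p := b) (by omega) (by omega)
    dsimp only
    rw [hf b (by omega), hf (L + 1 - b) (by omega), Nat.cast_sub (by omega)]
    push_cast
    rwa [div_lt_one p1]

lemma RatioMonotone.increasingBelowOne_upper (h : RatioMonotone L a)
    (hf : ∀ k : ℕ, k ≤ L → f k = a k) {b : ℕ} (hb : 2 ≤ b) (hbL : 2 * b < L + 2) :
    IncreasingBelowOne (fun k => f (L + 2 - k) / f k) 2 b := by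
  refine ⟨hb, fun k hk hkb => ?_, ?_⟩
  · have h1 := h.upper k (k + 1) (by omega) (by omega) (by omega)
    have p1 := h.pos k (by omega) (by omega)
    have p2 := h.pos (k + 1) (by omega) (by omega)
    dsimp only
    rw [hf k (by omega), hf (k + 1) (by omega), hf (L + 2 - k) (by omega),
      hf (L + 2 - (k + 1)) (by omega), Nat.cast_sub (by omega), Nat.cast_sub (by omega)]
    rw [minor] at h1
    push_cast
    rw [show (2 : ℤ) + L = L + 2 by ring] at h1
    rw [div_lt_div_iff₀ p1 p2]
    linarith
  · have p1 := h.pos b (by omega) (by omega)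
    have h1 := h.reflect_lt (p := b - 1) (by omega) (by omega)
    rw [sub_add_cancel, show (L : ℤ) + 1 - (b - 1) = L + 2 - b by ring] at h1
    dsimp only
    rw [hf b (by omega), hf (L + 2 - b) (by omega), Nat.cast_sub (by omega)]
    push_cast
    rwa [div_lt_one p1]

lemma RatioMonotone.spiral (h : RatioMonotone L a) (hf : ∀ k : ℕ, k ≤ L → f k = a k) :
    Spiral f L := by
  refine ⟨fun k h1 h2 => ?_, fun k h1 h2 => ?_⟩
  · rw [hf k (by omega), hf (L + 1 - k) (by omega), Nat.cast_sub (by omega)]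
    exact h.lt_reflect (by omega) (by omega)
  · rw [hf (k + 1) (by omega), hf (L + 1 - k) (by omega), Nat.cast_sub (by omega)]
    exact h.reflect_lt (by omega) (by omega)

lemma RatioMonotone.strictlyLogConcave (h : RatioMonotone L a)
    (hf : ∀ k : ℕ, k ≤ L → f k = a k) : StrictlyLogConcave f L := by
  refine ⟨fun k h1 h2 => ?_, fun k h1 h2 => ?_⟩
  · rw [hf k h2]
    exact h.pos k (by omega) (by omega)
  · rw [hf k (by omega), hf (k + 1) (by omega), hf (k + 2) (by omega)]
    push_cast
    have p0 := h.pos k (by omega) (by omega)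
    have p1 := h.pos (k + 1) (by omega) (by omega)
    have p2 := h.pos (k + 2) (by omega) (by omega)
    have p3 := h.pos (L + 1 - k) (by omega) (by omega)
    have k1 := h.lower k (k + 1) (by omega) (by omega) (by omega)
    have k2 := h.upper (k + 1) (k + 2) (by omega) (by omega) (by omega)
    rw [minor, show (1 : ℤ) + L - (k + 1) = L - k by ring,
      show (1 : ℤ) + L - k = L + 1 - k by ring] at k1
    rw [minor, show (2 : ℤ) + L - (k + 2) = L - k by ring,
      show (2 : ℤ) + L - (k + 1) = L + 1 - k by ring] at k2
    rw [div_lt_div_iff₀ p1 p2]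
    refine lt_of_mul_lt_mul_right ?_ p3.le
    -- A lower and an upper minor share the factors `a (L - k)` and `a (L + 1 - k)`; eliminating `a
    -- (L - k)` leaves the log-concavity inequality times `a (L + 1 - k)`.
    have q1 := mul_pos p1 k1
    have q2 := mul_pos p0 k2
    linarith

end Consequences

/-! ### Transfer to the q-derangement numbers -/

lemma A_eq (n k : ℕ) :
    A n k = coeffSeq (core n) k + if Even n ∧ k = n.choose 2 then 1 else 0 := by
  rw [A, coeffSeq_natCast, core]
  by_cases hn : Even n
  · simp [hn, Polynomial.coeff_X_pow]
  · simp [hn]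

lemma A_eq_of_le {n : ℕ} (hn : 6 ≤ n) (k : ℕ) (hk : k ≤ n.choose 2 - 1) :
    A n k = coeffSeq (core n) k := by
  have h1 : 1 ≤ n.choose 2 := Nat.choose_pos (by omega)
  rw [A_eq, if_neg (by omega), add_zero]

lemma beta_even {n : ℕ} (h : Even n) : beta n = n.choose 2 := if_pos h

lemma beta_odd {n : ℕ} (h : Odd n) : beta n = n.choose 2 - 1 :=
  if_neg (Nat.not_even_iff_odd.2 h)

lemma A_pos {n : ℕ} (hn : 6 ≤ n) (k : ℕ) (h1 : 1 ≤ k) (hk : k ≤ beta n) : 0 < A n k := by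
  have h := ratioMonotone_core n hn
  by_cases hkL : k ≤ n.choose 2 - 1
  · rw [A_eq_of_le hn k hkL]
    exact h.pos k (by omega) (by omega)
  · rcases Nat.even_or_odd n with he | ho
    · rw [beta_even he] at hk
      rw [A_eq, h.zero k (by omega), if_pos ⟨he, by omega⟩]
      norm_num
    · rw [beta_odd ho] at hk
      omega

lemma natDegree_d_of_six_le {n : ℕ} (hn : 6 ≤ n) : (d n).natDegree = beta n := by
  have h := ratioMonotone_core n hn
  have hb : n.choose 2 - 1 ≤ beta n := by
    rw [beta]
    split_ifs <;> omega
  have h1 : 2 ≤ n.choose 2 :=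
    (show 2 ≤ (3).choose 2 by decide).trans (Nat.choose_le_choose 2 (by omega))
  apply Polynomial.natDegree_eq_of_le_of_coeff_ne_zero
  · rw [Polynomial.natDegree_le_iff_coeff_eq_zero]
    intro k hk
    have hA : A n k = 0 := by
      rw [A_eq, h.zero k (by omega), if_neg, add_zero]
      rintro ⟨he, rfl⟩
      rw [beta_even he] at hk
      exact lt_irrefl _ hk
    simpa [A] using hA
  · intro h0
    have := A_pos hn (beta n) (by omega) le_rfl
    rw [A, h0] at this
    simp at this

lemma natDegree_d_and_A_zero (n : ℕ) (hn : 2 ≤ n) : (d n).natDegree = beta n ∧ A n 0 = 0 := by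
  by_cases h6 : 6 ≤ n
  · exact ⟨natDegree_d_of_six_le h6, by
      rw [A_eq_of_le h6 0 (Nat.zero_le _), (ratioMonotone_core n h6).zero _ (by simp)]⟩
  · have hn5 : n ≤ 5 := by omega
    interval_cases n
    · rw [A, d_two, show beta 2 = 1 by decide]
      simp
    · rw [A, d_three, show beta 3 = 2 by decide]
      exact ⟨by compute_degree!, by simp⟩
    · rw [A, d_four, show beta 4 = 6 by decide]
      exact ⟨by compute_degree!, by simp⟩
    · rw [A, d_five, show beta 5 = 9 by decide]
      exact ⟨by compute_degree!, by simp⟩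

end QDerangement
open QDerangement in
theorem theorem1 :
    -- the degree of `d_n(q)` is `β_n`, and `d_n(q)` has no constant term
    (∀ n : ℕ, 2 ≤ n → (d n).natDegree = beta n ∧ A n 0 = 0) ∧
    ∀ n : ℕ, 6 ≤ n →
      -- all quotients below are quotients of positive numbers
      (∀ k, 1 ≤ k → k ≤ beta n → 0 < A n k) ∧
      -- the two ratio sequences, by the residue of `n` modulo 4 (all divisions defining `r` are exact)
      (n % 4 = 1 → ∀ r : ℕ, r = n * (n - 1) / 4 →
        IncreasingBelowOne (fun k => A n k / A n (beta n + 1 - k)) 1 (r - 1) ∧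
        beta n + 1 - (r - 1) = r + 1 ∧
        IncreasingBelowOne (fun k => A n (beta n + 2 - k) / A n k) 2 r ∧
        beta n + 2 - r = r + 1) ∧
      (n % 4 = 2 → ∀ r : ℕ, r = (n * (n - 1) - 2) / 4 →
        IncreasingBelowOne (fun k => A n k / A n (beta n - k)) 1 r ∧
        beta n - r = r + 1 ∧
        IncreasingBelowOne (fun k => A n (beta n + 1 - k) / A n k) 2 r ∧
        beta n + 1 - r = r + 2) ∧
      (n % 4 = 3 → ∀ r : ℕ, r = (n * (n - 1) - 2) / 4 →
        IncreasingBelowOne (fun k => A n k / A n (beta n + 1 - k)) 1 r ∧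
        beta n + 1 - r = r + 1 ∧
        IncreasingBelowOne (fun k => A n (beta n + 2 - k) / A n k) 2 r ∧
        beta n + 2 - r = r + 2) ∧
      (n % 4 = 0 → ∀ r : ℕ, r = n * (n - 1) / 4 →
        IncreasingBelowOne (fun k => A n k / A n (beta n - k)) 1 (r - 1) ∧
        beta n - (r - 1) = r + 1 ∧
        IncreasingBelowOne (fun k => A n (beta n + 1 - k) / A n k) 2 r ∧
        beta n + 1 - r = r + 1) ∧
      -- the spiral property and log-concavity, without the last coefficient when `n` is even
      (Odd n → Spiral (A n) (beta n) ∧ StrictlyLogConcave (A n) (beta n)) ∧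
      (Even n → Spiral (A n) (beta n - 1) ∧ StrictlyLogConcave (A n) (beta n - 1)) := by

  refine ⟨natDegree_d_and_A_zero, fun n hn => ?_⟩
  have h := ratioMonotone_core n hn
  have hA := A_eq_of_le hn
  have hc : n.choose 2 * 2 = n * (n - 1) := by
    rw [Nat.choose_two_right, Nat.div_mul_cancel (Nat.even_mul_pred_self n).two_dvd]
  have h30 : 6 * 5 ≤ n * (n - 1) := Nat.mul_le_mul hn (by omega)
  -- Shows `n * (n - 1)` modulo 4 with the quadratic part as an atom, which lets `omega` evaluate
  -- the divisions defining `r`.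
  have hm : ∀ q s, n = 4 * q + s + 1 →
      n * (n - 1) = 4 * (4 * q ^ 2 + q * (2 * s + 1)) + s * (s + 1) := by
    rintro q s rfl
    rw [Nat.add_sub_cancel]
    ring
  -- With `beta n` written as `L + 1`, the reflections for even `n` take the forms `L + 1 - k` and
  -- `L + 2 - k` used for odd `n`.
  have even : Even n → beta n = n.choose 2 - 1 + 1 := fun he => by
    rw [beta_even he]
    omega
  refine ⟨A_pos hn, fun hmod r hr => ?_, fun hmod r hr => ?_, fun hmod r hr => ?_,
    fun hmod r hr => ?_, fun ho => ?_, fun he => ?_⟩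
  · have hr' := hm (n / 4) 0 (by omega)
    rw [beta_odd (Nat.odd_iff.2 (by omega))]
    exact ⟨h.increasingBelowOne_lower hA (by omega) (by omega), by omega,
      h.increasingBelowOne_upper hA (by omega) (by omega), by omega⟩
  · have hr' := hm (n / 4) 1 (by omega)
    rw [even (Nat.even_iff.2 (by omega))]
    exact ⟨h.increasingBelowOne_lower hA (by omega) (by omega), by omega,
      h.increasingBelowOne_upper hA (by omega) (by omega), by omega⟩
  · have hr' := hm (n / 4) 2 (by omega)
    rw [beta_odd (Nat.odd_iff.2 (by omega))]
    exact ⟨h.increasingBelowOne_lower hA (by omega) (by omega), by omega,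
      h.increasingBelowOne_upper hA (by omega) (by omega), by omega⟩
  · have hr' := hm (n / 4 - 1) 3 (by omega)
    rw [even (Nat.even_iff.2 (by omega))]
    exact ⟨h.increasingBelowOne_lower hA (by omega) (by omega), by omega,
      h.increasingBelowOne_upper hA (by omega) (by omega), by omega⟩
  · rw [beta_odd ho]
    exact ⟨h.spiral hA, h.strictlyLogConcave hA⟩
  · rw [beta_even he]
    exact ⟨h.spiral hA, h.strictlyLogConcave hA⟩
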